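/- Let $(M_1^{n_1},g_1)$ and $(M_2^{n_2},g_2)$ be connected smooth Riemannian manifolds without boundary, $n_2\ge 1$, let $\varphi\in C^\infty(M_1)$ be positive, and let $(M,g)=(M_1\times M_2,\;g_1\oplus\varphi^2g_2)$ be the warped product. Let $f_i\in C^\infty(M_i,\mathbb{R})$, $i=1,2$, and assume that $f(x_1,x_2):=f_1(x_1)f_2(x_2)$ does not vanish identically on $M$. Hessians $\nabla^2h:=\nabla\nabla h$ and Ricci tensors are regarded as $(1,1)$-tensors, and $\Delta h:=-\mathrm{tr}(\nabla^2h)$; the index $i$ refers to $(M_i,g_i)$. Then $\nabla^2f=-f\cdot\mathrm{Ric}$ holds on $(M,g)$ if and only if one of the following occurs: (a) The function $f_1/\varphi$ is constant on $M_1$, say equal to $c$ (then $c\neq0$ and $f=\varphi\cdot(cf_2)$, so that after replacing $(f_1,f_2)$ by $(\varphi,cf_2)$ we may assume $f_1=\varphi$), and, with this normalisation, the function $\mu_1:=(n_2-2)|\nabla f_1|_1^2-f_1\Delta_1f_1$ is constant on $M_1$, and $$(n_2-1)\nabla_1^2f_1=f_1\cdot\mathrm{Ric}_1\ \text{ on }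 M_1,\qquad \nabla_2^2f_2=f_2\cdot(\mu_1\,\mathrm{Id}-\mathrm{Ric}_2)\ \text{ on } M_2 .$$ (b) The function $f_2$ is constant on $M_2$; the function $f_1$ satisfies $$\nabla_1^2f_1=-f_1\cdot\Big(\mathrm{Ric}_1-\frac{n_2}{\varphi}\nabla_1^2\varphi\Big)\ \text{ on } M_1;$$ the function $$\mu_1':=-\frac{\varphi}{f_1}\,g_1(\nabla f_1,\nabla\varphi)+(n_2-1)|\nabla\varphi|_1^2-\varphi\,\Delta_1\varphi$$ is constant on each connected component of $M_1\setminus f_1^{-1}(\{0\})$; and $(M_2,g_2)$ is Einstein (that is, $\mathrm{Ric}_2$ is a constant multiple of $\mathrm{Id}$) with scalar curvature equal to $n_2\,\mu_1'(x_1)$ for every $x_1\in M_1\setminus f_1^{-1}(\{0\})$. -/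

import Mathlib

set_option maxSynthPendingDepth 3

open scoped Manifold ContDiff

noncomputable section

/-- The pull-back `(v, w) ↦ B(A v, A w)` of a bilinear form by a linear map. -/
def pullbackForm {V W : Type*}
    [AddCommGroup V] [Module ℝ V] [TopologicalSpace V] [IsTopologicalAddGroup V]
    [ContinuousSMul ℝ V]
    [AddCommGroup W] [Module ℝ W] [TopologicalSpace W] [IsTopologicalAddGroup W]
    [ContinuousSMul ℝ W]
    (B : W →L[ℝ] W →L[ℝ] ℝ) (A : V →L[ℝ] W) : V →L[ℝ] V →L[ℝ] ℝ :=
  (ContinuousLinearMap.precomp ℝ A) ∘L B ∘L A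

theorem pullbackForm_apply {V W : Type*}
    [AddCommGroup V] [Module ℝ V] [TopologicalSpace V] [IsTopologicalAddGroup V]
    [ContinuousSMul ℝ V]
    [AddCommGroup W] [Module ℝ W] [TopologicalSpace W] [IsTopologicalAddGroup W]
    [ContinuousSMul ℝ W]
    (B : W →L[ℝ] W →L[ℝ] ℝ) (A : V →L[ℝ] W) (v w : V) :
    pullbackForm B A v w = B (A v) (A w) := rfl

/-! ### Riemannian geometry of a metric written in coordinates

`G : E → E →L[ℝ] E →L[ℝ] ℝ` is a field of symmetric positive definite bilinear forms on (an open
subset of) the finite-dimensional space `E`, i.e. the matrix-valued function `(g_{ij})`. -/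

namespace CoordMetric

variable {E : Type*} [NormedAddCommGroup E] [NormedSpace ℝ E]

/-- The musical isomorphism `E* → E` of `G u`: the inverse of `v ↦ G u v`. -/
def sharp (G : E → E →L[ℝ] E →L[ℝ] ℝ) (u : E) : (E →L[ℝ] ℝ) →L[ℝ] E :=
  (G u).inverse

/-- Twice the Christoffel symbols of the first kind, `(v, w, y) ↦
(∂_v G)(w, y) + (∂_w G)(v, y) - (∂_y G)(v, w)`. -/
def christoffelFirst (G : E → E →L[ℝ] E →L[ℝ] ℝ) (u : E) : E →L[ℝ] E →L[ℝ] E →L[ℝ] ℝ :=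
  fderiv ℝ G u + (fderiv ℝ G u).flip -
    ContinuousLinearMap.comp
      ((ContinuousLinearMap.flipₗᵢ ℝ E E ℝ).toContinuousLinearEquiv :
        (E →L[ℝ] E →L[ℝ] ℝ) →L[ℝ] (E →L[ℝ] E →L[ℝ] ℝ)) (fderiv ℝ G u).flip

/-- The Christoffel symbols `Γ_u(v, w)` of the Levi-Civita connection. -/
def christoffel (G : E → E →L[ℝ] E →L[ℝ] ℝ) (u : E) : E →L[ℝ] E →L[ℝ] E :=
  (1 / 2 : ℝ) •
    ((ContinuousLinearMap.compL ℝ E (E →L[ℝ] ℝ) E (sharp G u)) ∘L christoffelFirst G u)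

/-- The covariant derivative `v ↦ ∇_v Y = ∂_v Y + Γ(v, Y)` of a vector field `Y`. -/
def covDeriv (G : E → E →L[ℝ] E →L[ℝ] ℝ) (Y : E → E) (u : E) : E →L[ℝ] E :=
  fderiv ℝ Y u + (christoffel G u).flip (Y u)

/-- The gradient of a function. -/
def gradient (G : E → E →L[ℝ] E →L[ℝ] ℝ) (h : E → ℝ) (u : E) : E :=
  sharp G u (fderiv ℝ h u)

/-- The Hessian `v ↦ ∇_v ∇h`, as a `(1,1)`-tensor. -/
def hessian (G : E → E →L[ℝ] E →L[ℝ] ℝ) (h : E → ℝ) (u : E) : E →L[ℝ] E :=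
  covDeriv G (gradient G h) u

/-- For fixed `w` and `z`, the endomorphism `v ↦ R(v, w) z`, where
`R(v, w) z = (∂_v Γ)(w, z) - (∂_w Γ)(v, z) + Γ(v, Γ(w, z)) - Γ(w, Γ(v, z))` is the curvature
tensor `∇_v ∇_w z - ∇_w ∇_v z - ∇_{[v, w]} z`. -/
def curvature (G : E → E →L[ℝ] E →L[ℝ] ℝ) (u w z : E) : E →L[ℝ] E :=
  ((fderiv ℝ (christoffel G) u).flip w).flip z - (fderiv ℝ (christoffel G) u w).flip z +
    (christoffel G u).flip (christoffel G u w z) -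
      (christoffel G u w) ∘L ((christoffel G u).flip z)

theorem curvature_apply (G : E → E →L[ℝ] E →L[ℝ] ℝ) (u v w z : E) :
    curvature G u w z v =
      fderiv ℝ (christoffel G) u v w z - fderiv ℝ (christoffel G) u w v z +
        christoffel G u v (christoffel G u w z) - christoffel G u w (christoffel G u v z) := by
  simp [curvature]

theorem christoffel_apply (G : E → E →L[ℝ] E →L[ℝ] ℝ) (u v w : E) :
    christoffel G u v w = (1 / 2 : ℝ) • sharp G u (christoffelFirst G u v w) := by
  simp [christoffel]

theorem christoffelFirst_apply (G : E → E →L[ℝ] E →L[ℝ] ℝ) (u v w y : E) :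
    christoffelFirst G u v w y =
      fderiv ℝ G u v w y + fderiv ℝ G u w v y - fderiv ℝ G u y v w := by
  simp [christoffelFirst]

/-- The Ricci curvature as a bilinear form, `ric(w, z) = tr (v ↦ R(v, w) z)`. -/
def ricciForm (G : E → E →L[ℝ] E →L[ℝ] ℝ) (u : E) : E →ₗ[ℝ] E →ₗ[ℝ] ℝ :=
  LinearMap.mk₂ ℝ (fun w z => LinearMap.trace ℝ E (curvature G u w z : E →ₗ[ℝ] E))
    (by
      intro w w' z
      rw [← map_add]
      congr 1
      ext v
      simp [curvature_apply]
      abel)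
    (by
      intro c w z
      rw [← map_smul]
      congr 1
      ext v
      simp [curvature_apply, smul_sub, smul_add])
    (by
      intro w z z'
      rw [← map_add]
      congr 1
      ext v
      simp [curvature_apply]
      abel)
    (by
      intro c w z
      rw [← map_smul]
      congr 1
      ext v
      simp [curvature_apply, smul_sub, smul_add])

variable [FiniteDimensional ℝ E]

/-- The Ricci tensor as a `(1,1)`-tensor: `G(Ric w, z) = ric(w, z)`. -/
def ricci (G : E → E →L[ℝ] E →L[ℝ] ℝ) (u : E) : E →L[ℝ] E :=
  sharp G u ∘L LinearMap.toContinuousLinearMap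
    ((LinearMap.toContinuousLinearMap : (E →ₗ[ℝ] ℝ) ≃ₗ[ℝ] (E →L[ℝ] ℝ)).toLinearMap ∘ₗ
      ricciForm G u)

end CoordMetric

/-! ### Riemannian geometry on a manifold without boundary

`g` is the metric tensor.  The tangent space `TangentSpace I x` is by definition the model space
`E`, the identification being the one given by the preferred chart at `x`; therefore a tensor at
`x` computed in this chart is a tensor on `TangentSpace I x`. -/

namespace RiemGeom

variable {E : Type*} [NormedAddCommGroup E] [NormedSpace ℝ E]
  {H : Type*} [TopologicalSpace H] {I : ModelWithCorners ℝ E H}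
  {M : Type*} [TopologicalSpace M] [ChartedSpace H M]

/-- The metric `g` written in the preferred chart at `x₀`, that is, its pull-back by the inverse
of the chart. -/
def inChart (g : (x : M) → TangentSpace I x →L[ℝ] TangentSpace I x →L[ℝ] ℝ) (x₀ : M) (u : E) :
    E →L[ℝ] E →L[ℝ] ℝ :=
  pullbackForm (g ((extChartAt I x₀).symm u)) (mfderiv 𝓘(ℝ, E) I (extChartAt I x₀).symm u)

/-- The gradient of `f` at `x`, defined by `g(∇f, ·) = df`. -/
def gradient (g : (x : M) → TangentSpace I x →L[ℝ] TangentSpace I x →L[ℝ] ℝ) (f : M → ℝ) (x : M) :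
    TangentSpace I x :=
  (g x).inverse (mfderiv I 𝓘(ℝ, ℝ) f x : TangentSpace I x →L[ℝ] ℝ)

/-- The Hessian `X ↦ ∇_X ∇f` of `f`, as a `(1,1)`-tensor. -/
def hessian (g : (x : M) → TangentSpace I x →L[ℝ] TangentSpace I x →L[ℝ] ℝ) (f : M → ℝ) (x : M) :
    TangentSpace I x →L[ℝ] TangentSpace I x :=
  CoordMetric.hessian (E := E) (inChart g x) (f ∘ (extChartAt I x).symm) (extChartAt I x x)

/-- The Laplacian with nonnegative spectrum, `Δf = -tr (∇²f)`. -/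
def laplacian (g : (x : M) → TangentSpace I x →L[ℝ] TangentSpace I x →L[ℝ] ℝ) (f : M → ℝ)
    (x : M) : ℝ :=
  -LinearMap.trace ℝ (TangentSpace I x) (hessian g f x).toLinearMap

/-- The function `μ₁(h) = (n₂ - 2) |∇h|² - h Δh`. -/
def muOne (g : (x : M) → TangentSpace I x →L[ℝ] TangentSpace I x →L[ℝ] ℝ) (n₂ : ℕ) (h : M → ℝ)
    (x : M) : ℝ :=
  ((n₂ : ℝ) - 2) * g x (gradient g h x) (gradient g h x) - h x * laplacian g h x

/-- The function `-(φ / h) g(∇h, ∇φ) + (n₂ - 1) |∇φ|² - φ Δφ`, meaningful where `h ≠ 0`. -/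
def muOne' (g : (x : M) → TangentSpace I x →L[ℝ] TangentSpace I x →L[ℝ] ℝ) (n₂ : ℕ)
    (φ h : M → ℝ) (x : M) : ℝ :=
  -(φ x / h x) * g x (gradient g h x) (gradient g φ x) +
    ((n₂ : ℝ) - 1) * g x (gradient g φ x) (gradient g φ x) - φ x * laplacian g φ x

variable [FiniteDimensional ℝ E]

/-- The Ricci tensor, as a `(1,1)`-tensor. -/
def ricci (g : (x : M) → TangentSpace I x →L[ℝ] TangentSpace I x →L[ℝ] ℝ) (x : M) :
    TangentSpace I x →L[ℝ] TangentSpace I x :=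
  CoordMetric.ricci (E := E) (inChart g x) (extChartAt I x x)

/-- The scalar curvature, the trace of the Ricci tensor. -/
def scalarCurvature (g : (x : M) → TangentSpace I x →L[ℝ] TangentSpace I x →L[ℝ] ℝ) (x : M) : ℝ :=
  LinearMap.trace ℝ (TangentSpace I x) (ricci g x).toLinearMap

/-- `(M, g)` is Einstein: `Ric = c · Id` for some constant `c`. -/
def IsEinstein (g : (x : M) → TangentSpace I x →L[ℝ] TangentSpace I x →L[ℝ] ℝ) : Prop :=
  ∃ c : ℝ, ∀ x, ricci g x = c • ContinuousLinearMap.id ℝ (TangentSpace I x)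

/-- The generalised Ricci-Hessian equation `∇²f = -f · Ric`. -/
def SolvesRicciHessian (g : (x : M) → TangentSpace I x →L[ℝ] TangentSpace I x →L[ℝ] ℝ)
    (f : M → ℝ) : Prop :=
  ∀ x, hessian g f x = -(f x • ricci g x)

end RiemGeom

/-- The warped product metric `g₁ ⊕ φ² g₂ = π₁^* g₁ + (φ ∘ π₁)² π₂^* g₂` on `M₁ × M₂`. -/
def warpedMetric
    {E₁ : Type*} [NormedAddCommGroup E₁] [NormedSpace ℝ E₁]
    {H₁ : Type*} [TopologicalSpace H₁] {I₁ : ModelWithCorners ℝ E₁ H₁}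
    {M₁ : Type*} [TopologicalSpace M₁] [ChartedSpace H₁ M₁]
    {E₂ : Type*} [NormedAddCommGroup E₂] [NormedSpace ℝ E₂]
    {H₂ : Type*} [TopologicalSpace H₂] {I₂ : ModelWithCorners ℝ E₂ H₂}
    {M₂ : Type*} [TopologicalSpace M₂] [ChartedSpace H₂ M₂]
    (g₁ : (x : M₁) → TangentSpace I₁ x →L[ℝ] TangentSpace I₁ x →L[ℝ] ℝ)
    (φ : M₁ → ℝ)
    (g₂ : (x : M₂) → TangentSpace I₂ x →L[ℝ] TangentSpace I₂ x →L[ℝ] ℝ)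
    (p : M₁ × M₂) :
    TangentSpace (I₁.prod I₂) p →L[ℝ] TangentSpace (I₁.prod I₂) p →L[ℝ] ℝ :=
  pullbackForm (g₁ p.1) (mfderiv (I₁.prod I₂) I₁ Prod.fst p) +
    (φ p.1) ^ 2 • pullbackForm (g₂ p.2) (mfderiv (I₁.prod I₂) I₂ Prod.snd p)

end

/-!
Both sides of `∇²f = -f · Ric` are computed explicitly on the warped product, and the equation is
then read off block by block.

In product charts the warped metric is `G₁ ⊕ ψ² G₂`. Since the Christoffel symbols are determined by
Koszul's formula `2 G(Γ(v, w), y) = (∂_v G)(w, y) + (∂_w G)(v, y) - (∂_y G)(v, w)`, they can be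
verified rather than computed (`christoffel_warp`); differentiating the result gives the Hessian of
a product `h₁ h₂` (`hessian_warp`) and the diagonal blocks of `v ↦ R(v, w) z`, hence the Ricci
tensor (`ricci_warp`). Transported to the manifold, with `n₂` the dimension of the second factor,

* `Ric (v, w) = (Ric₁ v - (n₂/φ) ∇²φ v, φ⁻² (Ric₂ w - κ w))`, where
  `κ = (n₂ - 1) |∇φ|² - φ Δφ`;
* `∇²(f₁ f₂)` has diagonal blocks `f₂ ∇²f₁` and `(f₁/φ²) ∇²f₂ + (f₂/φ) g₁(∇f₁, ∇φ) Id`, and mixed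
  blocks that pair `d(f₁/φ)` with `df₂`.

As the Ricci tensor has no mixed blocks, the equation forces `d(f₁/φ) ⊗ df₂ = 0`
(`solvesRicciHessian_warpedMetric_iff`), so by connectedness `f₁/φ` or `f₂` is constant. In each of
the two cases the diagonal blocks are the asserted equations, after division by a nonzero value of
the other function.

Only one step needs more than this pointwise algebra. In the second case the block along the second
factor is `φ g₁(∇f₁, ∇φ) = f₁ (κ - c)`, where `Ric₂ = c Id`; the hypothesis on `μ₁'` gives it only
where `f₁ ≠ 0`. It extends to the closure of this set by continuity, and in the interior of the zero
set both sides vanish (`mul_modelDeriv_gradient_eq_of_muOne'`). The Laplacian at a point is defined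
through the preferred chart at that very point, so its continuity (`continuous_laplacian`) rests on
the invariance of the Hessian under changes of coordinates (`IsPullbackAt.hessian_comp`).
-/

/-! ### Metrics in coordinates -/

namespace CoordMetric

open Filter Topology

section Basic

variable {E : Type*} [NormedAddCommGroup E] [NormedSpace ℝ E]

/-- `G` is a smooth field of symmetric nondegenerate bilinear forms on the open set `s`.
Positivity plays no role in the coordinate computations. -/
structure IsMetricOn (G : E → E →L[ℝ] E →L[ℝ] ℝ) (s : Set E) : Prop where
  isOpen : IsOpen s
  contDiffAt : ∀ u ∈ s, ContDiffAt ℝ ∞ G u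
  symm : ∀ u ∈ s, ∀ v w, G u v w = G u w v
  isInvertible : ∀ u ∈ s, (G u).IsInvertible

variable {G : E → E →L[ℝ] E →L[ℝ] ℝ} {s : Set E} {u : E}

theorem apply_sharp (hG : (G u).IsInvertible) (α : E →L[ℝ] ℝ) : G u (sharp G u α) = α :=
  hG.self_apply_inverse α

theorem sharp_eq_of_apply_eq (hG : (G u).IsInvertible) {α : E →L[ℝ] ℝ} {v : E}
    (h : ∀ y, G u v y = α y) : sharp G u α = v :=
  hG.injective ((apply_sharp hG α).trans (ContinuousLinearMap.ext fun y => (h y).symm))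

theorem eq_of_apply_eq (hG : (G u).IsInvertible) {v w : E} (h : ∀ y, G u v y = G u w y) :
    v = w :=
  hG.injective (ContinuousLinearMap.ext h)

theorem apply_gradient (hG : (G u).IsInvertible) (h : E → ℝ) (v : E) :
    G u (gradient G h u) v = fderiv ℝ h u v := by
  rw [gradient, apply_sharp hG]

/-- Koszul's formula, which characterizes the Christoffel symbols. -/
theorem apply_christoffel (hG : (G u).IsInvertible) (v w y : E) :
    G u (christoffel G u v w) y = (1 / 2 : ℝ) *
      (fderiv ℝ G u v w y + fderiv ℝ G u w v y - fderiv ℝ G u y v w) := by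
  rw [christoffel_apply, map_smul, apply_sharp hG]
  simp [christoffelFirst_apply]

theorem fderiv_apply_apply {F : Type*} [NormedAddCommGroup F] [NormedSpace ℝ F]
    {A : E → E →L[ℝ] E →L[ℝ] F} (hA : DifferentiableAt ℝ A u) (v w y : E) :
    fderiv ℝ A u v w y = fderiv ℝ (fun u => A u w y) u v := by
  have h1 : HasFDerivAt (fun u => A u w y)
      (((fderiv ℝ A u).flip w).flip y) u := by
    have := (hA.hasFDerivAt.clm_apply (hasFDerivAt_const w u)).clm_apply (hasFDerivAt_const y u)
    convert this using 1
    ext v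
    simp
  rw [h1.fderiv]
  rfl

namespace IsMetricOn

variable (hG : IsMetricOn G s) (hu : u ∈ s)
include hG hu

theorem mem_nhds : s ∈ 𝓝 u := hG.isOpen.mem_nhds hu

theorem differentiableAt : DifferentiableAt ℝ G u :=
  (hG.contDiffAt u hu).differentiableAt (by simp)

theorem fderiv_symm (v w y : E) : fderiv ℝ G u v w y = fderiv ℝ G u v y w := by
  rw [fderiv_apply_apply (hG.differentiableAt hu), fderiv_apply_apply (hG.differentiableAt hu)]
  have : (fun u => G u w y) =ᶠ[𝓝 u] fun u => G u y w := by
    filter_upwards [hG.mem_nhds hu] with u' hu' using hG.symm u' hu' w y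
  rw [this.fderiv_eq]

theorem christoffel_symm (v w : E) : christoffel G u v w = christoffel G u w v := by
  refine eq_of_apply_eq (hG.isInvertible u hu) fun y => ?_
  rw [apply_christoffel (hG.isInvertible u hu), apply_christoffel (hG.isInvertible u hu),
    hG.fderiv_symm hu y v w]
  ring

variable [CompleteSpace E]

theorem contDiffAt_sharp : ContDiffAt ℝ ∞ (sharp G) u :=
  ((hG.isInvertible u hu).contDiffAt_map_inverse (n := ∞)).comp u (hG.contDiffAt u hu)

theorem contDiffAt_gradient {h : E → ℝ} (hh : ContDiffAt ℝ ∞ h u) :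
    ContDiffAt ℝ ∞ (gradient G h) u :=
  (hG.contDiffAt_sharp hu).clm_apply (hh.fderiv_right (m := ∞) (by simp))

theorem contDiffAt_christoffel : ContDiffAt ℝ ∞ (christoffel G) u := by
  have h1 : ContDiffAt ℝ ∞ (fderiv ℝ G) u := (hG.contDiffAt u hu).fderiv_right (m := ∞) (by simp)
  have h2 : ContDiffAt ℝ ∞ (fun u => (fderiv ℝ G u).flip) u :=
    (ContinuousLinearMap.flipₗᵢ ℝ E E (E →L[ℝ] ℝ)).toContinuousLinearEquiv.contDiff.contDiffAt.comp
      u h1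
  have h3 : ContDiffAt ℝ ∞ (christoffelFirst G) u :=
    (h1.add h2).sub (contDiffAt_const.clm_comp h2)
  exact ContDiffAt.const_smul (1 / 2 : ℝ)
    ((((ContinuousLinearMap.compL ℝ E (E →L[ℝ] ℝ) E).contDiff.contDiffAt).comp u
      (hG.contDiffAt_sharp hu)).clm_comp h3)

/-- The Hessian as a bilinear form, `g(∇_w ∇h, z) = D²h(w, z) - dh(Γ(w, z))`. -/
theorem apply_hessian {h : E → ℝ} (hh : ContDiffAt ℝ ∞ h u) (w z : E) :
    G u (hessian G h u w) z = fderiv ℝ (fderiv ℝ h) u w z - fderiv ℝ h u (christoffel G u w z) := by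
  have hi := hG.isInvertible u hu
  have hgr : DifferentiableAt ℝ (gradient G h) u :=
    (hG.contDiffAt_gradient hu hh).differentiableAt (by simp)
  have hd : DifferentiableAt ℝ (fderiv ℝ h) u :=
    (hh.fderiv_right (m := ∞) (by simp)).differentiableAt (by simp)
  -- differentiate the identity `G(∇h, z) = dh(z)` in the direction `w`
  have key : fderiv ℝ G u w (gradient G h u) z + G u (fderiv ℝ (gradient G h) u w) z =
      fderiv ℝ (fderiv ℝ h) u w z := by
    have e : (fun u => G u (gradient G h u) z) =ᶠ[𝓝 u] fun u => fderiv ℝ h u z := by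
      filter_upwards [hG.mem_nhds hu] with u' hu' using apply_gradient (hG.isInvertible u' hu') h z
    have h1 := ((hG.differentiableAt hu).hasFDerivAt.clm_apply hgr.hasFDerivAt).clm_apply
      (hasFDerivAt_const z u)
    have h2 := hd.hasFDerivAt.clm_apply (hasFDerivAt_const z u)
    have h3 := congrArg (fun L : E →L[ℝ] ℝ => L w) ((h1.congr_of_eventuallyEq e.symm).unique h2)
    simp only [_root_.add_apply, ContinuousLinearMap.comp_apply,
      ContinuousLinearMap.flip_apply, _root_.zero_apply, map_zero, zero_add] at h3
    linarith
  rw [hessian, covDeriv, _root_.add_apply, map_add, _root_.add_apply,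
    ContinuousLinearMap.flip_apply, apply_christoffel hi, ← apply_gradient hi,
    hG.symm u hu (gradient G h u), apply_christoffel hi, ← key,
    hG.fderiv_symm hu w z (gradient G h u), hG.fderiv_symm hu z w (gradient G h u)]
  ring

end IsMetricOn

end Basic

end CoordMetric

/-! ### Warped products in coordinates -/

namespace CoordMetric

open Filter Topology

section Warped

variable {E₁ : Type*} [NormedAddCommGroup E₁] [NormedSpace ℝ E₁]
  {E₂ : Type*} [NormedAddCommGroup E₂] [NormedSpace ℝ E₂]

/-- The warped product `G₁ ⊕ ψ² G₂` of two metrics written in coordinates. -/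
noncomputable def warp (G₁ : E₁ → E₁ →L[ℝ] E₁ →L[ℝ] ℝ) (ψ : E₁ → ℝ)
    (G₂ : E₂ → E₂ →L[ℝ] E₂ →L[ℝ] ℝ) (u : E₁ × E₂) : (E₁ × E₂) →L[ℝ] (E₁ × E₂) →L[ℝ] ℝ :=
  pullbackForm (G₁ u.1) (ContinuousLinearMap.fst ℝ E₁ E₂) +
    ψ u.1 ^ 2 • pullbackForm (G₂ u.2) (ContinuousLinearMap.snd ℝ E₁ E₂)

/-- Two coordinate metrics on open sets `s₁`, `s₂`, and a smooth nonvanishing warping function on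
`s₁`. -/
structure IsWarpedOn (G₁ : E₁ → E₁ →L[ℝ] E₁ →L[ℝ] ℝ) (ψ : E₁ → ℝ)
    (G₂ : E₂ → E₂ →L[ℝ] E₂ →L[ℝ] ℝ) (s₁ : Set E₁) (s₂ : Set E₂) : Prop where
  left : IsMetricOn G₁ s₁
  right : IsMetricOn G₂ s₂
  contDiffAt : ∀ u ∈ s₁, ContDiffAt ℝ ∞ ψ u
  ne_zero : ∀ u ∈ s₁, ψ u ≠ 0

variable {G₁ : E₁ → E₁ →L[ℝ] E₁ →L[ℝ] ℝ} {ψ : E₁ → ℝ} {G₂ : E₂ → E₂ →L[ℝ] E₂ →L[ℝ] ℝ}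
  {s₁ : Set E₁} {s₂ : Set E₂} {u : E₁ × E₂}

theorem warp_apply (u v w : E₁ × E₂) :
    warp G₁ ψ G₂ u v w = G₁ u.1 v.1 w.1 + ψ u.1 ^ 2 * G₂ u.2 v.2 w.2 := by
  simp [warp, pullbackForm_apply]

namespace IsWarpedOn

section General

variable (hW : IsWarpedOn G₁ ψ G₂ s₁ s₂)
include hW

theorem isMetricOn_warp : IsMetricOn (warp G₁ ψ G₂) (s₁ ×ˢ s₂) where
  isOpen := hW.left.isOpen.prod hW.right.isOpen
  contDiffAt u hu := by
    have h1 : ContDiffAt ℝ ∞ (fun u : E₁ × E₂ => G₁ u.1) u :=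
      (hW.left.contDiffAt _ hu.1).comp u contDiffAt_fst
    have h2 : ContDiffAt ℝ ∞ (fun u : E₁ × E₂ => G₂ u.2) u :=
      (hW.right.contDiffAt _ hu.2).comp u contDiffAt_snd
    have h3 : ContDiffAt ℝ ∞ (fun u : E₁ × E₂ => ψ u.1) u :=
      (hW.contDiffAt _ hu.1).comp u contDiffAt_fst
    exact (contDiffAt_const.clm_comp (h1.clm_comp contDiffAt_const)).add
      ((h3.pow 2).smul (contDiffAt_const.clm_comp (h2.clm_comp contDiffAt_const)))
  symm u hu v w := by
    rw [warp_apply, warp_apply, hW.left.symm _ hu.1, hW.right.symm _ hu.2]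
  isInvertible u hu := by
    have h1 := hW.left.isInvertible _ hu.1
    have h2 := hW.right.isInvertible _ hu.2
    have h3 := hW.ne_zero _ hu.1
    refine ContinuousLinearMap.IsInvertible.of_inverse
      (g := ((sharp G₁ u.1).comp
        (ContinuousLinearMap.precomp ℝ (ContinuousLinearMap.inl ℝ E₁ E₂))).prod
        ((ψ u.1 ^ 2)⁻¹ • (sharp G₂ u.2).comp
          (ContinuousLinearMap.precomp ℝ (ContinuousLinearMap.inr ℝ E₁ E₂)))) ?_ ?_
    · refine ContinuousLinearMap.ext fun α => ContinuousLinearMap.ext fun y => ?_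
      simp only [ContinuousLinearMap.comp_apply, warp_apply, ContinuousLinearMap.prod_apply,
        _root_.smul_apply, map_smul, apply_sharp h1, apply_sharp h2,
        ContinuousLinearMap.id_apply, smul_eq_mul]
      rw [mul_inv_cancel_left₀ (pow_ne_zero 2 h3)]
      simp [← map_add]
    · refine ContinuousLinearMap.ext fun v => Prod.ext ?_ ?_
      · refine sharp_eq_of_apply_eq h1 fun y => ?_
        simp [warp_apply]
      · have : sharp G₂ u.2 ((warp G₁ ψ G₂ u v).comp (ContinuousLinearMap.inr ℝ E₁ E₂)) =
            ψ u.1 ^ 2 • v.2 := by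
          refine sharp_eq_of_apply_eq h2 fun y => ?_
          simp [warp_apply]
        change (ψ u.1 ^ 2)⁻¹ • sharp G₂ u.2
          ((warp G₁ ψ G₂ u v).comp (ContinuousLinearMap.inr ℝ E₁ E₂)) = v.2
        rw [this, inv_smul_smul₀ (pow_ne_zero 2 h3)]

variable (hu : u ∈ s₁ ×ˢ s₂)
include hu

theorem fderiv_warp (v w y : E₁ × E₂) :
    fderiv ℝ (warp G₁ ψ G₂) u v w y = fderiv ℝ G₁ u.1 v.1 w.1 y.1 +
      (2 * ψ u.1 * fderiv ℝ ψ u.1 v.1 * G₂ u.2 w.2 y.2 +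
        ψ u.1 ^ 2 * fderiv ℝ G₂ u.2 v.2 w.2 y.2) := by
  rw [fderiv_apply_apply (hW.isMetricOn_warp.differentiableAt hu)]
  simp only [warp_apply]
  have d1 : HasFDerivAt (fun u : E₁ × E₂ => G₁ u.1) _ u :=
    (hW.left.differentiableAt hu.1).hasFDerivAt.comp u hasFDerivAt_fst
  have d2 : HasFDerivAt (fun u : E₁ × E₂ => G₂ u.2) _ u :=
    (hW.right.differentiableAt hu.2).hasFDerivAt.comp u hasFDerivAt_snd
  have d3 : HasFDerivAt (fun u : E₁ × E₂ => ψ u.1) _ u :=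
    ((hW.contDiffAt _ hu.1).differentiableAt (by simp)).hasFDerivAt.comp u hasFDerivAt_fst
  have d1' := (d1.clm_apply (hasFDerivAt_const w.1 u)).clm_apply (hasFDerivAt_const y.1 u)
  have d2' := (d2.clm_apply (hasFDerivAt_const w.2 u)).clm_apply (hasFDerivAt_const y.2 u)
  rw [(d1'.fun_add ((d3.pow 2).fun_mul d2')).fderiv]
  simp
  ring

/-- The Christoffel symbols of a warped product. -/
theorem christoffel_warp (v w : E₁ × E₂) :
    christoffel (warp G₁ ψ G₂) u v w =
      (christoffel G₁ u.1 v.1 w.1 - (ψ u.1 * G₂ u.2 v.2 w.2) • gradient G₁ ψ u.1,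
        christoffel G₂ u.2 v.2 w.2 + (fderiv ℝ ψ u.1 v.1 / ψ u.1) • w.2 +
          (fderiv ℝ ψ u.1 w.1 / ψ u.1) • v.2) := by
  have hi := hW.isMetricOn_warp.isInvertible u hu
  have h0 := hW.ne_zero _ hu.1
  refine eq_of_apply_eq hi fun y => ?_
  rw [apply_christoffel hi, hW.fderiv_warp hu, hW.fderiv_warp hu, hW.fderiv_warp hu, warp_apply]
  simp only [map_add, map_sub, map_smul, _root_.add_apply, _root_.sub_apply, _root_.smul_apply,
    smul_eq_mul, apply_gradient (hW.left.isInvertible _ hu.1),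
    apply_christoffel (hW.left.isInvertible _ hu.1),
    apply_christoffel (hW.right.isInvertible _ hu.2)]
  field_simp
  ring

/-- The gradient of a product of functions of the two factors. -/
theorem gradient_warp {h₁ : E₁ → ℝ} {h₂ : E₂ → ℝ} (d₁ : DifferentiableAt ℝ h₁ u.1)
    (d₂ : DifferentiableAt ℝ h₂ u.2) :
    gradient (warp G₁ ψ G₂) (fun u => h₁ u.1 * h₂ u.2) u =
      (h₂ u.2 • gradient G₁ h₁ u.1, (h₁ u.1 / ψ u.1 ^ 2) • gradient G₂ h₂ u.2) := by
  have hi := hW.isMetricOn_warp.isInvertible u hu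
  have h0 := hW.ne_zero _ hu.1
  have e₁ : HasFDerivAt (fun u : E₁ × E₂ => h₁ u.1) _ u := d₁.hasFDerivAt.comp u hasFDerivAt_fst
  have e₂ : HasFDerivAt (fun u : E₁ × E₂ => h₂ u.2) _ u := d₂.hasFDerivAt.comp u hasFDerivAt_snd
  refine eq_of_apply_eq hi fun y => ?_
  rw [apply_gradient hi, (e₁.fun_mul e₂).fderiv, warp_apply]
  simp only [map_smul, _root_.smul_apply, smul_eq_mul, _root_.add_apply,
    apply_gradient (hW.left.isInvertible _ hu.1), apply_gradient (hW.right.isInvertible _ hu.2),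
    ContinuousLinearMap.comp_apply, ContinuousLinearMap.coe_fst', ContinuousLinearMap.coe_snd']
  field_simp
  ring

end General

section Complete

variable [CompleteSpace E₁] [CompleteSpace E₂] (hW : IsWarpedOn G₁ ψ G₂ s₁ s₂)
  (hu : u ∈ s₁ ×ˢ s₂)
include hW hu

/-- The Hessian of a product of functions of the two factors.  The mixed terms contain
`d(h₁/ψ) = (dh₁ - (h₁/ψ) dψ)/ψ`. -/
theorem hessian_warp {h₁ : E₁ → ℝ} {h₂ : E₂ → ℝ} (d₁ : ∀ u ∈ s₁, ContDiffAt ℝ ∞ h₁ u)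
    (d₂ : ∀ u ∈ s₂, ContDiffAt ℝ ∞ h₂ u) (v : E₁ × E₂) :
    hessian (warp G₁ ψ G₂) (fun u => h₁ u.1 * h₂ u.2) u v =
      (h₂ u.2 • hessian G₁ h₁ u.1 v.1 + fderiv ℝ h₂ u.2 v.2 •
          (gradient G₁ h₁ u.1 - (h₁ u.1 / ψ u.1) • gradient G₁ ψ u.1),
        (h₁ u.1 / ψ u.1 ^ 2) • hessian G₂ h₂ u.2 v.2 +
          (h₂ u.2 * fderiv ℝ ψ u.1 (gradient G₁ h₁ u.1) / ψ u.1) • v.2 +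
          ((fderiv ℝ h₁ u.1 v.1 - h₁ u.1 / ψ u.1 * fderiv ℝ ψ u.1 v.1) / ψ u.1 ^ 2) •
            gradient G₂ h₂ u.2) := by
  have h0 := hW.ne_zero _ hu.1
  have e : gradient (warp G₁ ψ G₂) (fun u => h₁ u.1 * h₂ u.2) =ᶠ[𝓝 u] fun u =>
      (h₂ u.2 • gradient G₁ h₁ u.1, (h₁ u.1 * (ψ u.1 ^ 2)⁻¹) • gradient G₂ h₂ u.2) := by
    filter_upwards [hW.isMetricOn_warp.mem_nhds hu] with u' hu'
    simpa only [div_eq_mul_inv] using hW.gradient_warp hu'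
      ((d₁ _ hu'.1).differentiableAt (by simp)) ((d₂ _ hu'.2).differentiableAt (by simp))
  have e₁ : HasFDerivAt (fun u : E₁ × E₂ => h₁ u.1) _ u :=
    ((d₁ _ hu.1).differentiableAt (by simp)).hasFDerivAt.comp u hasFDerivAt_fst
  have e₂ : HasFDerivAt (fun u : E₁ × E₂ => h₂ u.2) _ u :=
    ((d₂ _ hu.2).differentiableAt (by simp)).hasFDerivAt.comp u hasFDerivAt_snd
  have e₃ : HasFDerivAt (fun u : E₁ × E₂ => ψ u.1) _ u :=
    ((hW.contDiffAt _ hu.1).differentiableAt (by simp)).hasFDerivAt.comp u hasFDerivAt_fst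
  have e₄ : HasFDerivAt (fun u : E₁ × E₂ => gradient G₁ h₁ u.1) _ u :=
    ((hW.left.contDiffAt_gradient hu.1 (d₁ _ hu.1)).differentiableAt
      (by simp)).hasFDerivAt.comp u hasFDerivAt_fst
  have e₅ : HasFDerivAt (fun u : E₁ × E₂ => gradient G₂ h₂ u.2) _ u :=
    ((hW.right.contDiffAt_gradient hu.2 (d₂ _ hu.2)).differentiableAt
      (by simp)).hasFDerivAt.comp u hasFDerivAt_snd
  have e₆ : HasFDerivAt (fun u : E₁ × E₂ => (ψ u.1 ^ 2)⁻¹) _ u :=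
    (hasFDerivAt_inv (pow_ne_zero 2 h0)).comp u (e₃.pow 2)
  have e₇ : HasFDerivAt (fun u : E₁ × E₂ => (h₂ u.2 • gradient G₁ h₁ u.1,
      (h₁ u.1 * (ψ u.1 ^ 2)⁻¹) • gradient G₂ h₂ u.2)) _ u :=
    (e₂.fun_smul e₄).prodMk ((e₁.fun_mul e₆).fun_smul e₅)
  rw [hessian, covDeriv, e.eq_of_nhds, e.fderiv_eq, e₇.fderiv, _root_.add_apply,
    ContinuousLinearMap.flip_apply, hW.christoffel_warp hu, hessian, hessian, covDeriv, covDeriv]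
  refine Prod.ext ?_ ?_
  · simp [apply_gradient (hW.right.isInvertible _ hu.2), hW.right.symm _ hu.2 v.2]
    match_scalars <;> field_simp
  · simp
    match_scalars <;> field_simp
    ring

end Complete

end IsWarpedOn

end Warped

end CoordMetric

/-! ### The curvature of a warped product in coordinates -/

namespace CoordMetric

open Filter Topology

/-- The trace of an endomorphism of a product is the sum of the traces of its diagonal blocks. -/
theorem trace_prod_eq_add {V W : Type*} [AddCommGroup V] [Module ℝ V] [FiniteDimensional ℝ V]
    [AddCommGroup W] [Module ℝ W] [FiniteDimensional ℝ W] (T : V × W →ₗ[ℝ] V × W) :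
    LinearMap.trace ℝ (V × W) T =
      LinearMap.trace ℝ V (LinearMap.fst ℝ V W ∘ₗ T ∘ₗ LinearMap.inl ℝ V W) +
        LinearMap.trace ℝ W (LinearMap.snd ℝ V W ∘ₗ T ∘ₗ LinearMap.inr ℝ V W) := by
  rw [LinearMap.trace_comp_comm' _ (LinearMap.fst ℝ V W),
    LinearMap.trace_comp_comm' _ (LinearMap.snd ℝ V W),
    ← map_add]
  congr 1
  refine LinearMap.ext fun x => ?_
  simp [← map_add]

theorem ricciForm_apply {E : Type*} [NormedAddCommGroup E] [NormedSpace ℝ E]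
    (G : E → E →L[ℝ] E →L[ℝ] ℝ) (u w z : E) :
    ricciForm G u w z = LinearMap.trace ℝ E (curvature G u w z : E →ₗ[ℝ] E) := rfl

theorem apply_ricci {E : Type*} [NormedAddCommGroup E] [NormedSpace ℝ E] [FiniteDimensional ℝ E]
    {G : E → E →L[ℝ] E →L[ℝ] ℝ} {u : E} (hG : (G u).IsInvertible) (w z : E) :
    G u (ricci G u w) z = ricciForm G u w z := by
  rw [ricci, ContinuousLinearMap.comp_apply, apply_sharp hG]
  rfl

namespace IsWarpedOn

variable {E₁ : Type*} [NormedAddCommGroup E₁] [NormedSpace ℝ E₁]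
  {E₂ : Type*} [NormedAddCommGroup E₂] [NormedSpace ℝ E₂]
variable {G₁ : E₁ → E₁ →L[ℝ] E₁ →L[ℝ] ℝ} {ψ : E₁ → ℝ} {G₂ : E₂ → E₂ →L[ℝ] E₂ →L[ℝ] ℝ}
  {s₁ : Set E₁} {s₂ : Set E₂} {u : E₁ × E₂}

section Complete

variable [CompleteSpace E₁] [CompleteSpace E₂] (hW : IsWarpedOn G₁ ψ G₂ s₁ s₂)
  (hu : u ∈ s₁ ×ˢ s₂)
include hW hu

theorem fderiv_christoffel_warp (v w z : E₁ × E₂) :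
    fderiv ℝ (christoffel (warp G₁ ψ G₂)) u v w z =
      (fderiv ℝ (christoffel G₁) u.1 v.1 w.1 z.1 -
          ((fderiv ℝ ψ u.1 v.1 * G₂ u.2 w.2 z.2 + ψ u.1 * fderiv ℝ G₂ u.2 v.2 w.2 z.2) •
              gradient G₁ ψ u.1 +
            (ψ u.1 * G₂ u.2 w.2 z.2) • fderiv ℝ (gradient G₁ ψ) u.1 v.1),
        fderiv ℝ (christoffel G₂) u.2 v.2 w.2 z.2 +
          (fderiv ℝ (fderiv ℝ ψ) u.1 v.1 w.1 / ψ u.1 -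
            fderiv ℝ ψ u.1 v.1 * fderiv ℝ ψ u.1 w.1 / ψ u.1 ^ 2) • z.2 +
          (fderiv ℝ (fderiv ℝ ψ) u.1 v.1 z.1 / ψ u.1 -
            fderiv ℝ ψ u.1 v.1 * fderiv ℝ ψ u.1 z.1 / ψ u.1 ^ 2) • w.2) := by
  have h0 := hW.ne_zero _ hu.1
  rw [fderiv_apply_apply
    ((hW.isMetricOn_warp.contDiffAt_christoffel hu).differentiableAt (by simp))]
  have e : (fun u => christoffel (warp G₁ ψ G₂) u w z) =ᶠ[𝓝 u] fun u =>
      (christoffel G₁ u.1 w.1 z.1 - (ψ u.1 * G₂ u.2 w.2 z.2) • gradient G₁ ψ u.1,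
        christoffel G₂ u.2 w.2 z.2 + (fderiv ℝ ψ u.1 w.1 * (ψ u.1)⁻¹) • z.2 +
          (fderiv ℝ ψ u.1 z.1 * (ψ u.1)⁻¹) • w.2) := by
    filter_upwards [hW.isMetricOn_warp.mem_nhds hu] with u' hu'
    simpa only [div_eq_mul_inv] using hW.christoffel_warp hu' w z
  have e₁ : HasFDerivAt (fun u : E₁ × E₂ => christoffel G₁ u.1) _ u :=
    ((hW.left.contDiffAt_christoffel hu.1).differentiableAt (by simp)).hasFDerivAt.comp u
      hasFDerivAt_fst
  have e₂ : HasFDerivAt (fun u : E₁ × E₂ => christoffel G₂ u.2) _ u :=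
    ((hW.right.contDiffAt_christoffel hu.2).differentiableAt (by simp)).hasFDerivAt.comp u
      hasFDerivAt_snd
  have e₃ : HasFDerivAt (fun u : E₁ × E₂ => ψ u.1) _ u :=
    ((hW.contDiffAt _ hu.1).differentiableAt (by simp)).hasFDerivAt.comp u hasFDerivAt_fst
  have e₄ : HasFDerivAt (fun u : E₁ × E₂ => gradient G₁ ψ u.1) _ u :=
    ((hW.left.contDiffAt_gradient hu.1 (hW.contDiffAt _ hu.1)).differentiableAt
      (by simp)).hasFDerivAt.comp u hasFDerivAt_fst
  have e₅ : HasFDerivAt (fun u : E₁ × E₂ => fderiv ℝ ψ u.1) _ u :=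
    (((hW.contDiffAt _ hu.1).fderiv_right (m := ∞) (by simp)).differentiableAt
      (by simp)).hasFDerivAt.comp u hasFDerivAt_fst
  have e₆ : HasFDerivAt (fun u : E₁ × E₂ => (ψ u.1)⁻¹) _ u := (hasFDerivAt_inv h0).comp u e₃
  have e₇ : HasFDerivAt (fun u : E₁ × E₂ => G₂ u.2) _ u :=
    (hW.right.differentiableAt hu.2).hasFDerivAt.comp u hasFDerivAt_snd
  have c₁ (a : E₁) : HasFDerivAt (𝕜 := ℝ) (fun _ : E₁ × E₂ => a) 0 u := hasFDerivAt_const a u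
  have c₂ (a : E₂) : HasFDerivAt (𝕜 := ℝ) (fun _ : E₁ × E₂ => a) 0 u := hasFDerivAt_const a u
  have e₈ : HasFDerivAt (fun u : E₁ × E₂ =>
      (christoffel G₁ u.1 w.1 z.1 - (ψ u.1 * G₂ u.2 w.2 z.2) • gradient G₁ ψ u.1,
        christoffel G₂ u.2 w.2 z.2 + (fderiv ℝ ψ u.1 w.1 * (ψ u.1)⁻¹) • z.2 +
          (fderiv ℝ ψ u.1 z.1 * (ψ u.1)⁻¹) • w.2)) _ u :=
    HasFDerivAt.prodMk
      (((e₁.clm_apply (c₁ w.1)).clm_apply (c₁ z.1)).fun_sub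
        ((e₃.fun_mul ((e₇.clm_apply (c₂ w.2)).clm_apply (c₂ z.2))).fun_smul e₄))
      ((((e₂.clm_apply (c₂ w.2)).clm_apply (c₂ z.2)).fun_add
        (((e₅.clm_apply (c₁ w.1)).fun_mul e₆).fun_smul (c₂ z.2))).fun_add
        (((e₅.clm_apply (c₁ z.1)).fun_mul e₆).fun_smul (c₂ w.2)))
  rw [e.fderiv_eq, e₈.fderiv]
  refine Prod.ext ?_ ?_
  · simp
    module
  · simp
    match_scalars <;> field_simp
    all_goals ring

/-- The block of `v ↦ R(v, w) z` along the first factor. -/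
theorem curvature_warp_inl (v : E₁) (w z : E₁ × E₂) :
    (curvature (warp G₁ ψ G₂) u w z (v, 0)).1 = curvature G₁ u.1 w.1 z.1 v -
      (ψ u.1 * G₂ u.2 w.2 z.2) • hessian G₁ ψ u.1 v := by
  have h0 := hW.ne_zero _ hu.1
  rw [curvature_apply, curvature_apply, hW.fderiv_christoffel_warp hu,
    hW.fderiv_christoffel_warp hu, hW.christoffel_warp hu, hW.christoffel_warp hu,
    hW.christoffel_warp hu, hW.christoffel_warp hu, hessian, covDeriv]
  simp
  match_scalars <;> field_simp
  ring

/-- The block of `v ↦ R(v, w) z` along the second factor. -/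
theorem curvature_warp_inr (v : E₂) (w z : E₁ × E₂) :
    (curvature (warp G₁ ψ G₂) u w z (0, v)).2 = curvature G₂ u.2 w.2 z.2 v -
      (G₁ u.1 (hessian G₁ ψ u.1 w.1) z.1 / ψ u.1 +
        fderiv ℝ ψ u.1 (gradient G₁ ψ u.1) * G₂ u.2 w.2 z.2) • v +
      fderiv ℝ ψ u.1 (gradient G₁ ψ u.1) • G₂ u.2 v z.2 • w.2 := by
  have h0 := hW.ne_zero _ hu.1
  rw [curvature_apply, curvature_apply, hW.fderiv_christoffel_warp hu,
    hW.fderiv_christoffel_warp hu, hW.christoffel_warp hu, hW.christoffel_warp hu,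
    hW.christoffel_warp hu, hW.christoffel_warp hu,
    hW.left.apply_hessian hu.1 (hW.contDiffAt _ hu.1)]
  simp [hW.right.christoffel_symm hu.2 w.2 v]
  match_scalars <;> field_simp <;> ring

end Complete

section FiniteDimensional

variable [FiniteDimensional ℝ E₁] [FiniteDimensional ℝ E₂] (hW : IsWarpedOn G₁ ψ G₂ s₁ s₂)
  (hu : u ∈ s₁ ×ˢ s₂)
include hW hu

/-- The Ricci form of a warped product: the sum of the traces of the two diagonal blocks of
`v ↦ R(v, w) z`. -/
theorem ricciForm_warp (w z : E₁ × E₂) :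
    ricciForm (warp G₁ ψ G₂) u w z = ricciForm G₁ u.1 w.1 z.1 -
      Module.finrank ℝ E₂ / ψ u.1 * G₁ u.1 (hessian G₁ ψ u.1 w.1) z.1 +
      ricciForm G₂ u.2 w.2 z.2 -
      (ψ u.1 * LinearMap.trace ℝ E₁ (hessian G₁ ψ u.1 : E₁ →ₗ[ℝ] E₁) +
        (Module.finrank ℝ E₂ - 1) * fderiv ℝ ψ u.1 (gradient G₁ ψ u.1)) * G₂ u.2 w.2 z.2 := by
  have := FiniteDimensional.complete ℝ E₁
  have := FiniteDimensional.complete ℝ E₂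
  rw [ricciForm_apply, ricciForm_apply, ricciForm_apply, trace_prod_eq_add]
  have b₁ : LinearMap.fst ℝ E₁ E₂ ∘ₗ (curvature (warp G₁ ψ G₂) u w z : E₁ × E₂ →ₗ[ℝ] E₁ × E₂) ∘ₗ
      LinearMap.inl ℝ E₁ E₂ = (curvature G₁ u.1 w.1 z.1 : E₁ →ₗ[ℝ] E₁) -
        (ψ u.1 * G₂ u.2 w.2 z.2) • (hessian G₁ ψ u.1 : E₁ →ₗ[ℝ] E₁) :=
    LinearMap.ext fun v => hW.curvature_warp_inl hu v w z
  have b₂ : LinearMap.snd ℝ E₁ E₂ ∘ₗ (curvature (warp G₁ ψ G₂) u w z : E₁ × E₂ →ₗ[ℝ] E₁ × E₂) ∘ₗ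
      LinearMap.inr ℝ E₁ E₂ = (curvature G₂ u.2 w.2 z.2 : E₂ →ₗ[ℝ] E₂) -
        (G₁ u.1 (hessian G₁ ψ u.1 w.1) z.1 / ψ u.1 +
          fderiv ℝ ψ u.1 (gradient G₁ ψ u.1) * G₂ u.2 w.2 z.2) • LinearMap.id +
        fderiv ℝ ψ u.1 (gradient G₁ ψ u.1) •
          ((G₂ u.2).flip z.2 : E₂ →ₗ[ℝ] ℝ).smulRight w.2 :=
    LinearMap.ext fun v => hW.curvature_warp_inr hu v w z
  rw [b₁, b₂]
  simp only [map_add, map_sub, map_smul, LinearMap.trace_id, LinearMap.trace_smulRight, smul_eq_mul,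
    ContinuousLinearMap.coe_coe, ContinuousLinearMap.flip_apply]
  ring

/-- The Ricci tensor of a warped product. -/
theorem ricci_warp (w : E₁ × E₂) :
    ricci (warp G₁ ψ G₂) u w =
      (ricci G₁ u.1 w.1 - ((Module.finrank ℝ E₂ : ℝ) / ψ u.1) • hessian G₁ ψ u.1 w.1,
        (ψ u.1 ^ 2)⁻¹ • (ricci G₂ u.2 w.2 -
          (ψ u.1 * LinearMap.trace ℝ E₁ (hessian G₁ ψ u.1 : E₁ →ₗ[ℝ] E₁) +
            (Module.finrank ℝ E₂ - 1) * fderiv ℝ ψ u.1 (gradient G₁ ψ u.1)) • w.2)) := by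
  have h0 := hW.ne_zero _ hu.1
  have hi := hW.isMetricOn_warp.isInvertible u hu
  refine eq_of_apply_eq hi fun z => ?_
  rw [apply_ricci hi, hW.ricciForm_warp hu, warp_apply]
  simp only [map_sub, map_smul, _root_.sub_apply, _root_.smul_apply, smul_eq_mul,
    apply_ricci (hW.left.isInvertible _ hu.1), apply_ricci (hW.right.isInvertible _ hu.2)]
  field_simp
  ring

end FiniteDimensional

end IsWarpedOn

end CoordMetric

/-! ### Changes of coordinates -/

namespace CoordMetric

open Filter Topology

section ChangeOfCoordinates

variable {E : Type*} [NormedAddCommGroup E] [NormedSpace ℝ E]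
  {G G' : E → E →L[ℝ] E →L[ℝ] ℝ} {s s' : Set E} {τ : E → E} {u : E}

/-- `G'` is the pull-back of `G` by the coordinate change `τ` near `u`. -/
structure IsPullbackAt (G' G : E → E →L[ℝ] E →L[ℝ] ℝ) (s' s : Set E) (τ : E → E) (u : E) :
    Prop where
  source : IsMetricOn G' s'
  target : IsMetricOn G s
  mem_source : u ∈ s'
  mem_target : τ u ∈ s
  contDiffAt : ContDiffAt ℝ ∞ τ u
  isInvertible : (fderiv ℝ τ u).IsInvertible
  eventuallyEq : G' =ᶠ[𝓝 u] fun u => pullbackForm (G (τ u)) (fderiv ℝ τ u)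

namespace IsPullbackAt

variable (hτ : IsPullbackAt G' G s' s τ u)
include hτ

theorem apply_eq (v w : E) : G' u v w = G (τ u) (fderiv ℝ τ u v) (fderiv ℝ τ u w) := by
  rw [hτ.eventuallyEq.eq_of_nhds, pullbackForm_apply]

theorem fderiv_comp {h : E → ℝ} (hh : DifferentiableAt ℝ h (τ u)) :
    fderiv ℝ (h ∘ τ) u = fderiv ℝ h (τ u) ∘L fderiv ℝ τ u :=
  _root_.fderiv_comp u hh (hτ.contDiffAt.differentiableAt (by simp))

theorem gradient_comp {h : E → ℝ} (hh : DifferentiableAt ℝ h (τ u)) :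
    fderiv ℝ τ u (gradient G' (h ∘ τ) u) = gradient G h (τ u) := by
  refine eq_of_apply_eq (hτ.target.isInvertible _ hτ.mem_target) fun y => ?_
  obtain ⟨z, rfl⟩ := hτ.isInvertible.surjective y
  rw [← hτ.apply_eq, apply_gradient (hτ.source.isInvertible _ hτ.mem_source),
    apply_gradient (hτ.target.isInvertible _ hτ.mem_target), hτ.fderiv_comp hh]
  rfl

theorem fderiv_gradient_comp {h k : E → ℝ} (hh : DifferentiableAt ℝ h (τ u))
    (hk : DifferentiableAt ℝ k (τ u)) :
    fderiv ℝ (k ∘ τ) u (gradient G' (h ∘ τ) u) = fderiv ℝ k (τ u) (gradient G h (τ u)) := by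
  rw [hτ.fderiv_comp hk, ContinuousLinearMap.comp_apply, hτ.gradient_comp hh]

theorem fderiv_apply (v w y : E) :
    fderiv ℝ G' u v w y =
      fderiv ℝ G (τ u) (fderiv ℝ τ u v) (fderiv ℝ τ u w) (fderiv ℝ τ u y) +
        G (τ u) (fderiv ℝ (fderiv ℝ τ) u v w) (fderiv ℝ τ u y) +
        G (τ u) (fderiv ℝ τ u w) (fderiv ℝ (fderiv ℝ τ) u v y) := by
  have d₁ := hτ.contDiffAt.differentiableAt (by simp)
  have d₂ : DifferentiableAt ℝ (fderiv ℝ τ) u :=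
    (hτ.contDiffAt.fderiv_right (m := ∞) (by simp)).differentiableAt (by simp)
  have d₃ : HasFDerivAt (fun u => G (τ u)) _ u :=
    (hτ.target.differentiableAt hτ.mem_target).hasFDerivAt.comp u d₁.hasFDerivAt
  have e : (fun u => G' u w y) =ᶠ[𝓝 u] fun u => G (τ u) (fderiv ℝ τ u w) (fderiv ℝ τ u y) := by
    filter_upwards [hτ.eventuallyEq] with u' hu'
    rw [hu', pullbackForm_apply]
  rw [fderiv_apply_apply (hτ.source.differentiableAt hτ.mem_source), e.fderiv_eq,
    ((d₃.clm_apply (d₂.hasFDerivAt.clm_apply (hasFDerivAt_const w u))).clm_apply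
      (d₂.hasFDerivAt.clm_apply (hasFDerivAt_const y u))).fderiv]
  simp
  ring

variable [CompleteSpace E]

/-- The Hessian is a tensor: it is invariant under changes of coordinates.  In the expression
`D²h - dh ∘ Γ`, both terms pick up the same additional summand `dh(D²τ)`. -/
theorem hessian_comp {h : E → ℝ} (hh : ContDiffAt ℝ ∞ h (τ u)) (w : E) :
    fderiv ℝ τ u (hessian G' (h ∘ τ) u w) = hessian G h (τ u) (fderiv ℝ τ u w) := by
  have i' := hτ.source.isInvertible _ hτ.mem_source
  have i := hτ.target.isInvertible _ hτ.mem_target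
  refine eq_of_apply_eq i fun y => ?_
  obtain ⟨z, rfl⟩ := hτ.isInvertible.surjective y
  have d₁ := hh.differentiableAt (by simp)
  have d₂ : DifferentiableAt ℝ (fderiv ℝ τ) u :=
    (hτ.contDiffAt.fderiv_right (m := ∞) (by simp)).differentiableAt (by simp)
  have d₃ : DifferentiableAt ℝ (fderiv ℝ h) (τ u) :=
    (hh.fderiv_right (m := ∞) (by simp)).differentiableAt (by simp)
  have hs : ∀ v w, fderiv ℝ (fderiv ℝ τ) u v w = fderiv ℝ (fderiv ℝ τ) u w v :=
    hτ.contDiffAt.isSymmSndFDerivAt (by simpa using WithTop.coe_le_coe.2 (le_top : (2 : ℕ∞) ≤ ⊤))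
  have sG := hτ.target.symm _ hτ.mem_target
  -- the Hessian of `h ∘ τ` in the sense of ordinary derivatives
  have second : fderiv ℝ (fderiv ℝ (h ∘ τ)) u w z =
      fderiv ℝ (fderiv ℝ h) (τ u) (fderiv ℝ τ u w) (fderiv ℝ τ u z) +
        fderiv ℝ h (τ u) (fderiv ℝ (fderiv ℝ τ) u w z) := by
    have e : fderiv ℝ (h ∘ τ) =ᶠ[𝓝 u] fun u => fderiv ℝ h (τ u) ∘L fderiv ℝ τ u := by
      have h₁ : ∀ᶠ v in 𝓝 (τ u), DifferentiableAt ℝ h v :=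
        ((hh.of_le (m := 1) (by norm_cast)).eventually (by simp)).mono
          fun v hv => hv.differentiableAt (by simp)
      have h₂ : ∀ᶠ v in 𝓝 u, DifferentiableAt ℝ τ v :=
        ((hτ.contDiffAt.of_le (m := 1) (by norm_cast)).eventually (by simp)).mono
          fun v hv => hv.differentiableAt (by simp)
      filter_upwards [hτ.contDiffAt.continuousAt.eventually h₁, h₂] with v h₁ h₂
      exact _root_.fderiv_comp v h₁ h₂
    have d₄ : HasFDerivAt (fun u => fderiv ℝ h (τ u)) _ u :=
      d₃.hasFDerivAt.comp u (hτ.contDiffAt.differentiableAt (by simp)).hasFDerivAt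
    rw [e.fderiv_eq, (d₄.clm_comp d₂.hasFDerivAt).fderiv]
    simp
    ring
  -- `dh` is expressed through `∇h`, so that the Christoffel terms become derivatives of the metric
  have first : ∀ v, fderiv ℝ (h ∘ τ) u v = G' u v (gradient G' (h ∘ τ) u) := fun v => by
    rw [hτ.source.symm _ hτ.mem_source, apply_gradient i']
  have first' : ∀ v, fderiv ℝ h (τ u) v = G (τ u) v (gradient G h (τ u)) := fun v => by
    rw [sG, apply_gradient i]
  have hh' : ContDiffAt ℝ ∞ (h ∘ τ) u := hh.comp u hτ.contDiffAt
  rw [← hτ.apply_eq, hτ.source.apply_hessian hτ.mem_source hh', second,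
    hτ.target.apply_hessian hτ.mem_target hh, first (christoffel G' u w z),
    first' (christoffel G (τ u) _ _), apply_christoffel i', apply_christoffel i,
    hτ.fderiv_apply, hτ.fderiv_apply, hτ.fderiv_apply, hτ.gradient_comp d₁, first',
    hs z w, hs (gradient G' (h ∘ τ) u) w, hs (gradient G' (h ∘ τ) u) z,
    sG (fderiv ℝ (fderiv ℝ τ) u w (gradient G' (h ∘ τ) u))]
  ring

theorem trace_hessian_comp {h : E → ℝ} (hh : ContDiffAt ℝ ∞ h (τ u)) :
    LinearMap.trace ℝ E (hessian G' (h ∘ τ) u : E →ₗ[ℝ] E) =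
      LinearMap.trace ℝ E (hessian G h (τ u) : E →ₗ[ℝ] E) := by
  obtain ⟨e, he⟩ := hτ.isInvertible
  rw [← LinearMap.trace_conj' (hessian G' (h ∘ τ) u : E →ₗ[ℝ] E) e.toLinearEquiv]
  congr 1
  refine LinearMap.ext fun v => ?_
  have := hτ.hessian_comp hh (e.symm v)
  rw [← he] at this
  simpa using this

end IsPullbackAt

end ChangeOfCoordinates

end CoordMetric

/-! ### Metrics in charts -/

namespace CoordMetric

open Filter Topology

section Congr

variable {E : Type*} [NormedAddCommGroup E] [NormedSpace ℝ E]
  {G G' : E → E →L[ℝ] E →L[ℝ] ℝ} {u : E}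

theorem sharp_congr (h : G u = G' u) : sharp G u = sharp G' u := by
  rw [sharp, sharp, h]

theorem christoffel_congr (h : G =ᶠ[𝓝 u] G') : christoffel G u = christoffel G' u := by
  rw [christoffel, christoffel, sharp_congr h.eq_of_nhds, christoffelFirst, christoffelFirst,
    h.fderiv_eq]

theorem christoffel_eventuallyEq (h : G =ᶠ[𝓝 u] G') : christoffel G =ᶠ[𝓝 u] christoffel G' :=
  h.eventuallyEq_nhds.mono fun _ => christoffel_congr

theorem gradient_congr {k k' : E → ℝ} (h : G u = G' u) (hk : k =ᶠ[𝓝 u] k') :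
    gradient G k u = gradient G' k' u := by
  rw [gradient, gradient, sharp_congr h, hk.fderiv_eq]

theorem hessian_congr {k k' : E → ℝ} (h : G =ᶠ[𝓝 u] G') (hk : k =ᶠ[𝓝 u] k') :
    hessian G k u = hessian G' k' u := by
  have e : gradient G k =ᶠ[𝓝 u] gradient G' k' := by
    filter_upwards [h.eventuallyEq_nhds, hk.eventuallyEq_nhds] with v hv hv'
    exact gradient_congr hv.eq_of_nhds hv'
  rw [hessian, hessian, covDeriv, covDeriv, e.fderiv_eq, e.eq_of_nhds, christoffel_congr h]

theorem ricci_congr [FiniteDimensional ℝ E] (h : G =ᶠ[𝓝 u] G') : ricci G u = ricci G' u := by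
  have e : ricciForm G u = ricciForm G' u := by
    refine LinearMap.ext fun w => LinearMap.ext fun z => ?_
    rw [ricciForm_apply, ricciForm_apply, curvature, curvature, christoffel_congr h,
      (christoffel_eventuallyEq h).fderiv_eq]
  rw [ricci, ricci, sharp_congr h.eq_of_nhds, e]

end Congr

/-- A positive definite form on a finite-dimensional space is nondegenerate. -/
theorem isInvertible_of_pos {E : Type*} [NormedAddCommGroup E] [NormedSpace ℝ E]
    [FiniteDimensional ℝ E] {B : E →L[ℝ] E →L[ℝ] ℝ} (hB : ∀ v, v ≠ 0 → 0 < B v v) :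
    B.IsInvertible := by
  have hi : Function.Injective (B : E →ₗ[ℝ] E →L[ℝ] ℝ) := by
    rw [injective_iff_map_eq_zero]
    intro v hv
    by_contra h0
    have h1 := hB v h0
    have h2 : B v = 0 := hv
    simp [h2] at h1
  have hd : Module.finrank ℝ E = Module.finrank ℝ (E →L[ℝ] ℝ) := by
    rw [← (LinearMap.toContinuousLinearMap : (E →ₗ[ℝ] ℝ) ≃ₗ[ℝ] (E →L[ℝ] ℝ)).finrank_eq]
    exact (Subspace.dual_finrank_eq (K := ℝ) (V := E)).symm
  exact ⟨(LinearMap.linearEquivOfInjective _ hi hd).toContinuousLinearEquiv, by ext v; rfl⟩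

end CoordMetric

namespace RiemGeom

open Filter Topology

section Chart

variable {E : Type*} [NormedAddCommGroup E] [NormedSpace ℝ E]
  {H : Type*} [TopologicalSpace H] {I : ModelWithCorners ℝ E H} [I.Boundaryless]
  {M : Type*} [TopologicalSpace M] [ChartedSpace H M] [IsManifold I ∞ M]

theorem mdifferentiableAt_extChartAt_symm {x : M} {u : E} (hu : u ∈ (extChartAt I x).target) :
    MDifferentiableAt 𝓘(ℝ, E) I (extChartAt I x).symm u := by
  have := mdifferentiableWithinAt_extChartAt_symm (I := I) hu
  rwa [I.range_eq_univ, mdifferentiableWithinAt_univ] at this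

theorem isInvertible_mfderiv_extChartAt_symm {x : M} {u : E}
    (hu : u ∈ (extChartAt I x).target) :
    (mfderiv 𝓘(ℝ, E) I (extChartAt I x).symm u).IsInvertible := by
  have := isInvertible_mfderivWithin_extChartAt_symm (I := I) hu
  rwa [I.range_eq_univ, mfderivWithin_univ] at this

variable (I) in
/-- The derivative at `u` of the inverse of the preferred chart at `x`, as an endomorphism of the
model space `E`. This definition and the next ones restate tensors on `TangentSpace I x`, which is
`E` by a definition that is not reducible, as tensors on `E` itself. -/
noncomputable def chartInvDeriv (x : M) (u : E) : E →L[ℝ] E :=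
  mfderiv 𝓘(ℝ, E) I (extChartAt I x).symm u

/-- The value at `x` of a field of forms, as a form on the model space. -/
def modelForm (g : (x : M) → TangentSpace I x →L[ℝ] TangentSpace I x →L[ℝ] ℝ) (x : M) :
    E →L[ℝ] E →L[ℝ] ℝ :=
  g x

variable (I) in
/-- The differential of a function, as a form on the model space. -/
noncomputable def modelDeriv (f : M → ℝ) (x : M) : E →L[ℝ] ℝ :=
  mfderiv I 𝓘(ℝ, ℝ) f x

/-- The gradient of a function, as a vector of the model space. -/
noncomputable def modelGradient
    (g : (x : M) → TangentSpace I x →L[ℝ] TangentSpace I x →L[ℝ] ℝ) (f : M → ℝ) (x : M) : E :=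
  gradient g f x

/-- The Hessian of a function, as an endomorphism of the model space. -/
noncomputable def modelHessian
    (g : (x : M) → TangentSpace I x →L[ℝ] TangentSpace I x →L[ℝ] ℝ) (f : M → ℝ) (x : M) :
    E →L[ℝ] E :=
  hessian g f x

/-- The Ricci tensor, as an endomorphism of the model space. -/
noncomputable def modelRicci [FiniteDimensional ℝ E]
    (g : (x : M) → TangentSpace I x →L[ℝ] TangentSpace I x →L[ℝ] ℝ) (x : M) : E →L[ℝ] E :=
  ricci g x

theorem isInvertible_chartInvDeriv {x : M} {u : E} (hu : u ∈ (extChartAt I x).target) :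
    (chartInvDeriv I x u).IsInvertible :=
  isInvertible_mfderiv_extChartAt_symm hu

theorem chartInvDeriv_self (x : M) :
    chartInvDeriv I x (extChartAt I x x) = ContinuousLinearMap.id ℝ E := by
  have := mfderivWithin_range_extChartAt_symm (I := I) (x := x)
  rw [I.range_eq_univ, mfderivWithin_univ] at this
  exact this

omit [I.Boundaryless] [IsManifold I ∞ M] in
theorem inChart_apply (g : (x : M) → TangentSpace I x →L[ℝ] TangentSpace I x →L[ℝ] ℝ) (x : M)
    (u v w : E) :
    inChart g x u v w = modelForm g ((extChartAt I x).symm u)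
      (chartInvDeriv I x u v) (chartInvDeriv I x u w) :=
  rfl

theorem inChart_self (g : (x : M) → TangentSpace I x →L[ℝ] TangentSpace I x →L[ℝ] ℝ) (x : M) :
    inChart g x (extChartAt I x x) = modelForm g x := by
  ext v w
  rw [inChart_apply, chartInvDeriv_self, extChartAt_to_inv]
  rfl

theorem contDiffAt_comp_extChartAt_symm {f : M → ℝ} (hf : ContMDiff I 𝓘(ℝ, ℝ) ∞ f)
    {x : M} {u : E} (hu : u ∈ (extChartAt I x).target) :
    ContDiffAt ℝ ∞ (f ∘ (extChartAt I x).symm) u := by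
  rw [← contMDiffAt_iff_contDiffAt]
  exact hf.contMDiffAt.comp u
    ((contMDiffOn_extChartAt_symm x).contMDiffAt ((isOpen_extChartAt_target x).mem_nhds hu))

omit [IsManifold I ∞ M] in
theorem modelDeriv_eq {f : M → ℝ} (hf : ContMDiff I 𝓘(ℝ, ℝ) ∞ f) (x : M) :
    modelDeriv I f x =
      fderiv ℝ (f ∘ (extChartAt I x).symm) (extChartAt I x x) := by
  have h : fderivWithin ℝ (writtenInExtChartAt I 𝓘(ℝ, ℝ) x f) (Set.range I) (extChartAt I x x) =
      fderiv ℝ (f ∘ (extChartAt I x).symm) (extChartAt I x x) := by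
    rw [I.range_eq_univ, fderivWithin_univ]
    rfl
  exact MDifferentiableAt.mfderiv (hf.mdifferentiable (by simp) x) |>.trans h

theorem modelGradient_eq {g : (x : M) → TangentSpace I x →L[ℝ] TangentSpace I x →L[ℝ] ℝ}
    {f : M → ℝ} (hf : ContMDiff I 𝓘(ℝ, ℝ) ∞ f) (x : M) :
    modelGradient g f x =
      CoordMetric.gradient (inChart g x) (f ∘ (extChartAt I x).symm) (extChartAt I x x) := by
  rw [CoordMetric.gradient, CoordMetric.sharp, inChart_self, ← modelDeriv_eq hf]
  rfl

end Chart

section Metric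

variable {E : Type*} [NormedAddCommGroup E] [NormedSpace ℝ E] [FiniteDimensional ℝ E]
  {M : Type*} [TopologicalSpace M] [ChartedSpace E M] [IsManifold 𝓘(ℝ, E) ∞ M]
  (g : Bundle.ContMDiffRiemannianMetric 𝓘(ℝ, E) ∞ E (fun x : M => TangentSpace 𝓘(ℝ, E) x))

theorem contDiffOn_inChart (x : M) :
    ContDiffOn ℝ ∞ (inChart g.inner x) (extChartAt 𝓘(ℝ, E) x).target := by
  rw [contDiffOn_clm_apply]
  intro v
  rw [contDiffOn_clm_apply]
  intro w
  set e := trivializationAt E (TangentSpace 𝓘(ℝ, E)) x with he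
  have hs (v : E) : ContMDiffOn 𝓘(ℝ, E) (𝓘(ℝ, E).prod 𝓘(ℝ, E)) ∞
      (fun y => Bundle.TotalSpace.mk' E (E := TangentSpace 𝓘(ℝ, E)) y (e.symm y v)) e.baseSet := by
    rw [e.contMDiffOn_section_baseSet_iff]
    refine (contMDiffOn_const (c := v)).congr fun y hy => ?_
    rw [e.apply_mk_symm hy]
  have h1 : ContMDiffOn 𝓘(ℝ, E) 𝓘(ℝ, ℝ) ∞
      (fun y => g.inner y (e.symm y v) (e.symm y w)) e.baseSet := by
    intro y hy
    have := ContMDiffWithinAt.clm_bundle_apply₂ (F₁ := E) (F₂ := E) (F₃ := ℝ)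
      (E₃ := Bundle.Trivial M ℝ) (b := id) (g.contMDiff.contMDiffOn (s := e.baseSet) y hy)
      (hs v y hy) (hs w y hy)
    rw [Bundle.contMDiffWithinAt_totalSpace] at this
    exact this.2
  rw [← contMDiffOn_iff_contDiffOn]
  have h2 := h1.comp (contMDiffOn_extChartAt_symm (I := 𝓘(ℝ, E)) (n := ∞) x) (fun u hu => by
    simpa [he] using (extChartAt 𝓘(ℝ, E) x).map_target hu)
  refine h2.congr fun u hu => ?_
  have hy : (extChartAt 𝓘(ℝ, E) x).symm u ∈ (chartAt E x).source := by
    simpa using (extChartAt 𝓘(ℝ, E) x).map_target hu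
  have h3 := TangentBundle.symmL_trivializationAt (𝕜 := ℝ) (I := 𝓘(ℝ, E)) hy
  rw [(extChartAt 𝓘(ℝ, E) x).right_inv hu, ModelWithCorners.range_eq_univ,
    mfderivWithin_univ] at h3
  have h4 (v : E) : chartInvDeriv 𝓘(ℝ, E) x u v = e.symm ((extChartAt 𝓘(ℝ, E) x).symm u) v := by
    rw [← e.symmL_apply (R := ℝ) hy]
    exact congrArg (fun A : E →L[ℝ] E => A v) h3.symm
  rw [inChart_apply, h4, h4]
  rfl

theorem isMetricOn_inChart (x : M) :
    CoordMetric.IsMetricOn (inChart g.inner x) (extChartAt 𝓘(ℝ, E) x).target where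
  isOpen := isOpen_extChartAt_target x
  contDiffAt u hu := (contDiffOn_inChart g x).contDiffAt ((isOpen_extChartAt_target x).mem_nhds hu)
  symm u _ v w := g.symm _ _ _
  isInvertible u hu := CoordMetric.isInvertible_of_pos fun v hv => by
    refine g.pos _ _ fun h => hv ?_
    exact (isInvertible_mfderiv_extChartAt_symm hu).injective (h.trans (map_zero _).symm)

/-- The transition map between two preferred charts pulls back the metric in the second chart to
the metric in the first chart. -/
theorem isPullbackAt_transition {x x' : M} (hx' : x' ∈ (extChartAt 𝓘(ℝ, E) x).source) :
    CoordMetric.IsPullbackAt (inChart g.inner x) (inChart g.inner x')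
      (extChartAt 𝓘(ℝ, E) x).target (extChartAt 𝓘(ℝ, E) x').target
      (extChartAt 𝓘(ℝ, E) x' ∘ (extChartAt 𝓘(ℝ, E) x).symm) (extChartAt 𝓘(ℝ, E) x x') := by
  have hu := (extChartAt 𝓘(ℝ, E) x).map_source hx'
  have hcont : ContinuousAt (extChartAt 𝓘(ℝ, E) x).symm (extChartAt 𝓘(ℝ, E) x x') :=
    continuousAt_extChartAt_symm'' hu
  have hev : ∀ᶠ u in 𝓝 (extChartAt 𝓘(ℝ, E) x x'), u ∈ (extChartAt 𝓘(ℝ, E) x).target ∧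
      (extChartAt 𝓘(ℝ, E) x).symm u ∈ (extChartAt 𝓘(ℝ, E) x').source := by
    refine Filter.Eventually.and ((isOpen_extChartAt_target x).mem_nhds hu) (hcont ?_)
    rw [(extChartAt 𝓘(ℝ, E) x).left_inv hx']
    exact extChartAt_source_mem_nhds x'
  have hd : ∀ᶠ u in 𝓝 (extChartAt 𝓘(ℝ, E) x x'), ContDiffAt ℝ ∞
      (extChartAt 𝓘(ℝ, E) x' ∘ (extChartAt 𝓘(ℝ, E) x).symm) u := by
    filter_upwards [hev] with u hu
    rw [← contMDiffAt_iff_contDiffAt]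
    exact (contMDiffAt_extChartAt' (by simpa using hu.2)).comp u
      ((contMDiffOn_extChartAt_symm x).contMDiffAt ((isOpen_extChartAt_target x).mem_nhds hu.1))
  have key : ∀ᶠ u in 𝓝 (extChartAt 𝓘(ℝ, E) x x'), chartInvDeriv 𝓘(ℝ, E) x u =
      chartInvDeriv 𝓘(ℝ, E) x' (extChartAt 𝓘(ℝ, E) x' ((extChartAt 𝓘(ℝ, E) x).symm u)) ∘L
        fderiv ℝ (extChartAt 𝓘(ℝ, E) x' ∘ (extChartAt 𝓘(ℝ, E) x).symm) u := by
    filter_upwards [hev.eventually_nhds, hd] with u hu hd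
    have e : (extChartAt 𝓘(ℝ, E) x).symm =ᶠ[𝓝 u] (extChartAt 𝓘(ℝ, E) x').symm ∘
        (extChartAt 𝓘(ℝ, E) x' ∘ (extChartAt 𝓘(ℝ, E) x).symm) := by
      filter_upwards [hu] with v hv
      exact ((extChartAt 𝓘(ℝ, E) x').left_inv hv.2).symm
    have h1 := e.mfderiv_eq (I := 𝓘(ℝ, E)) (I' := 𝓘(ℝ, E))
    have h2 := mfderiv_comp u (mdifferentiableAt_extChartAt_symm (I := 𝓘(ℝ, E))
      ((extChartAt 𝓘(ℝ, E) x').map_source hu.self_of_nhds.2))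
      (hd.differentiableAt (by simp)).mdifferentiableAt
    rw [mfderiv_eq_fderiv] at h2
    exact h1.trans h2
  have hτ : (extChartAt 𝓘(ℝ, E) x' ∘ (extChartAt 𝓘(ℝ, E) x).symm) (extChartAt 𝓘(ℝ, E) x x') =
      extChartAt 𝓘(ℝ, E) x' x' := by
    rw [Function.comp_apply, (extChartAt 𝓘(ℝ, E) x).left_inv hx']
  refine ⟨isMetricOn_inChart g x, isMetricOn_inChart g x', hu, ?_, hd.self_of_nhds, ?_, ?_⟩
  · rw [hτ]
    exact mem_extChartAt_target x'
  · have h1 := key.self_of_nhds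
    rw [(extChartAt 𝓘(ℝ, E) x).left_inv hx', chartInvDeriv_self,
      ContinuousLinearMap.id_comp] at h1
    rw [← h1]
    exact isInvertible_chartInvDeriv hu
  · filter_upwards [hev, key] with u hu hk
    ext v w
    rw [pullbackForm_apply, inChart_apply, inChart_apply, hk, Function.comp_apply,
      (extChartAt 𝓘(ℝ, E) x').left_inv hu.2]
    rfl

end Metric

end RiemGeom

/-! ### Warped product manifolds -/

namespace RiemGeom

open Filter Topology

section WarpedProduct

variable {E₁ : Type*} [NormedAddCommGroup E₁] [NormedSpace ℝ E₁]
  {M₁ : Type*} [TopologicalSpace M₁] [ChartedSpace E₁ M₁] [IsManifold 𝓘(ℝ, E₁) ∞ M₁]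
  {E₂ : Type*} [NormedAddCommGroup E₂] [NormedSpace ℝ E₂]
  {M₂ : Type*} [TopologicalSpace M₂] [ChartedSpace E₂ M₂] [IsManifold 𝓘(ℝ, E₂) ∞ M₂]

omit [IsManifold 𝓘(ℝ, E₁) ∞ M₁] [IsManifold 𝓘(ℝ, E₂) ∞ M₂] in
theorem mem_target_prod {p : M₁ × M₂} {u : E₁ × E₂}
    (hu : u ∈ (extChartAt 𝓘(ℝ, E₁) p.1).target ×ˢ (extChartAt 𝓘(ℝ, E₂) p.2).target) :
    u ∈ (extChartAt (𝓘(ℝ, E₁).prod 𝓘(ℝ, E₂)) p).target := by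
  rw [extChartAt_prod]
  exact hu

omit [IsManifold 𝓘(ℝ, E₁) ∞ M₁] [IsManifold 𝓘(ℝ, E₂) ∞ M₂] in
theorem mem_target_prod_self (p : M₁ × M₂) :
    (extChartAt 𝓘(ℝ, E₁) p.1 p.1, extChartAt 𝓘(ℝ, E₂) p.2 p.2) ∈
      (extChartAt 𝓘(ℝ, E₁) p.1).target ×ˢ (extChartAt 𝓘(ℝ, E₂) p.2).target :=
  ⟨mem_extChartAt_target p.1, mem_extChartAt_target p.2⟩

/-- In product charts, the warped product metric is the coordinate warped product. -/
theorem inChart_warpedMetric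
    (g₁ : (x : M₁) → TangentSpace 𝓘(ℝ, E₁) x →L[ℝ] TangentSpace 𝓘(ℝ, E₁) x →L[ℝ] ℝ)
    (φ : M₁ → ℝ)
    (g₂ : (x : M₂) → TangentSpace 𝓘(ℝ, E₂) x →L[ℝ] TangentSpace 𝓘(ℝ, E₂) x →L[ℝ] ℝ)
    {p : M₁ × M₂} {u : E₁ × E₂}
    (hu : u ∈ (extChartAt 𝓘(ℝ, E₁) p.1).target ×ˢ (extChartAt 𝓘(ℝ, E₂) p.2).target) :
    inChart (warpedMetric g₁ φ g₂) p u =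
      CoordMetric.warp (inChart g₁ p.1) (φ ∘ (extChartAt 𝓘(ℝ, E₁) p.1).symm)
        (inChart g₂ p.2) u := by
  set q : M₁ × M₂ := (extChartAt (𝓘(ℝ, E₁).prod 𝓘(ℝ, E₂)) p).symm u with hq
  have hd := mdifferentiableAt_extChartAt_symm (I := 𝓘(ℝ, E₁).prod 𝓘(ℝ, E₂)) (mem_target_prod hu)
  have hd₁ := mdifferentiableAt_extChartAt_symm (I := 𝓘(ℝ, E₁)) hu.1
  have hd₂ := mdifferentiableAt_extChartAt_symm (I := 𝓘(ℝ, E₂)) hu.2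
  have e₁ : (mfderiv (𝓘(ℝ, E₁).prod 𝓘(ℝ, E₂)) 𝓘(ℝ, E₁) Prod.fst q : E₁ × E₂ →L[ℝ] E₁) ∘L
      chartInvDeriv (𝓘(ℝ, E₁).prod 𝓘(ℝ, E₂)) p u =
      chartInvDeriv 𝓘(ℝ, E₁) p.1 u.1 ∘L ContinuousLinearMap.fst ℝ E₁ E₂ := by
    have h₁ := mfderiv_comp u (mdifferentiableAt_fst (I := 𝓘(ℝ, E₁)) (I' := 𝓘(ℝ, E₂)) (x := q)) hd
    have h₂ := mfderiv_comp u hd₁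
      (hasFDerivAt_fst (𝕜 := ℝ) (p := u)).differentiableAt.mdifferentiableAt
    rw [mfderiv_eq_fderiv, fderiv_fst] at h₂
    refine h₁.symm.trans (Eq.trans ?_ h₂)
    congr 1
  have e₂ : (mfderiv (𝓘(ℝ, E₁).prod 𝓘(ℝ, E₂)) 𝓘(ℝ, E₂) Prod.snd q : E₁ × E₂ →L[ℝ] E₂) ∘L
      chartInvDeriv (𝓘(ℝ, E₁).prod 𝓘(ℝ, E₂)) p u =
      chartInvDeriv 𝓘(ℝ, E₂) p.2 u.2 ∘L ContinuousLinearMap.snd ℝ E₁ E₂ := by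
    have h₁ := mfderiv_comp u (mdifferentiableAt_snd (I := 𝓘(ℝ, E₁)) (I' := 𝓘(ℝ, E₂)) (x := q)) hd
    have h₂ := mfderiv_comp u hd₂
      (hasFDerivAt_snd (𝕜 := ℝ) (p := u)).differentiableAt.mdifferentiableAt
    rw [mfderiv_eq_fderiv, fderiv_snd] at h₂
    refine h₁.symm.trans (Eq.trans ?_ h₂)
    congr 1
  have hq₁ : q.1 = (extChartAt 𝓘(ℝ, E₁) p.1).symm u.1 := by rw [hq, extChartAt_prod]; rfl
  have hq₂ : q.2 = (extChartAt 𝓘(ℝ, E₂) p.2).symm u.2 := by rw [hq, extChartAt_prod]; rfl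
  refine ContinuousLinearMap.ext fun v => ContinuousLinearMap.ext fun w => ?_
  have k₁ (v : E₁ × E₂) := congrArg (fun A : E₁ × E₂ →L[ℝ] E₁ => A v) e₁
  have k₂ (v : E₁ × E₂) := congrArg (fun A : E₁ × E₂ →L[ℝ] E₂ => A v) e₂
  have h : inChart (warpedMetric g₁ φ g₂) p u v w =
      modelForm g₁ q.1
        (((mfderiv (𝓘(ℝ, E₁).prod 𝓘(ℝ, E₂)) 𝓘(ℝ, E₁) Prod.fst q : E₁ × E₂ →L[ℝ] E₁) ∘L
          chartInvDeriv (𝓘(ℝ, E₁).prod 𝓘(ℝ, E₂)) p u) v)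
        (((mfderiv (𝓘(ℝ, E₁).prod 𝓘(ℝ, E₂)) 𝓘(ℝ, E₁) Prod.fst q : E₁ × E₂ →L[ℝ] E₁) ∘L
          chartInvDeriv (𝓘(ℝ, E₁).prod 𝓘(ℝ, E₂)) p u) w) +
      φ q.1 ^ 2 * modelForm g₂ q.2
        (((mfderiv (𝓘(ℝ, E₁).prod 𝓘(ℝ, E₂)) 𝓘(ℝ, E₂) Prod.snd q : E₁ × E₂ →L[ℝ] E₂) ∘L
          chartInvDeriv (𝓘(ℝ, E₁).prod 𝓘(ℝ, E₂)) p u) v)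
        (((mfderiv (𝓘(ℝ, E₁).prod 𝓘(ℝ, E₂)) 𝓘(ℝ, E₂) Prod.snd q : E₁ × E₂ →L[ℝ] E₂) ∘L
          chartInvDeriv (𝓘(ℝ, E₁).prod 𝓘(ℝ, E₂)) p u) w) := rfl
  rw [h, e₁, e₂, hq₁, hq₂, CoordMetric.warp_apply, inChart_apply, inChart_apply]
  rfl

theorem inChart_warpedMetric_eventuallyEq
    (g₁ : (x : M₁) → TangentSpace 𝓘(ℝ, E₁) x →L[ℝ] TangentSpace 𝓘(ℝ, E₁) x →L[ℝ] ℝ)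
    (φ : M₁ → ℝ)
    (g₂ : (x : M₂) → TangentSpace 𝓘(ℝ, E₂) x →L[ℝ] TangentSpace 𝓘(ℝ, E₂) x →L[ℝ] ℝ)
    (p : M₁ × M₂) :
    inChart (warpedMetric g₁ φ g₂) p
      =ᶠ[𝓝 (extChartAt 𝓘(ℝ, E₁) p.1 p.1, extChartAt 𝓘(ℝ, E₂) p.2 p.2)]
      CoordMetric.warp (inChart g₁ p.1) (φ ∘ (extChartAt 𝓘(ℝ, E₁) p.1).symm)
        (inChart g₂ p.2) := by
  filter_upwards [((isOpen_extChartAt_target (I := 𝓘(ℝ, E₁)) p.1).prod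
    (isOpen_extChartAt_target (I := 𝓘(ℝ, E₂)) p.2)).mem_nhds (mem_target_prod_self p)] with u hu
  exact inChart_warpedMetric _ _ _ hu

variable [FiniteDimensional ℝ E₁] [FiniteDimensional ℝ E₂]
  (g₁ : Bundle.ContMDiffRiemannianMetric 𝓘(ℝ, E₁) ∞ E₁
    (fun x : M₁ => TangentSpace 𝓘(ℝ, E₁) x))
  (g₂ : Bundle.ContMDiffRiemannianMetric 𝓘(ℝ, E₂) ∞ E₂
    (fun x : M₂ => TangentSpace 𝓘(ℝ, E₂) x))
  {φ : M₁ → ℝ} (hφ : ContMDiff 𝓘(ℝ, E₁) 𝓘(ℝ, ℝ) ∞ φ) (hφ_pos : ∀ x, 0 < φ x)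
include hφ hφ_pos

theorem isWarpedOn_inChart (p : M₁ × M₂) :
    CoordMetric.IsWarpedOn (inChart g₁.inner p.1) (φ ∘ (extChartAt 𝓘(ℝ, E₁) p.1).symm)
      (inChart g₂.inner p.2) (extChartAt 𝓘(ℝ, E₁) p.1).target
      (extChartAt 𝓘(ℝ, E₂) p.2).target where
  left := isMetricOn_inChart g₁ p.1
  right := isMetricOn_inChart g₂ p.2
  contDiffAt _ hu := contDiffAt_comp_extChartAt_symm hφ hu
  ne_zero _ _ := (hφ_pos _).ne'

/-- The Hessian of `f₁ f₂` on a warped product. -/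
theorem hessian_warpedMetric {f₁ : M₁ → ℝ} (hf₁ : ContMDiff 𝓘(ℝ, E₁) 𝓘(ℝ, ℝ) ∞ f₁)
    {f₂ : M₂ → ℝ} (hf₂ : ContMDiff 𝓘(ℝ, E₂) 𝓘(ℝ, ℝ) ∞ f₂) (p : M₁ × M₂) (v : E₁ × E₂) :
    modelHessian (warpedMetric g₁.inner φ g₂.inner) (fun p : M₁ × M₂ => f₁ p.1 * f₂ p.2) p v =
      (f₂ p.2 • modelHessian g₁.inner f₁ p.1 v.1 +
          modelDeriv 𝓘(ℝ, E₂) f₂ p.2 v.2 •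
          (modelGradient g₁.inner f₁ p.1 - (f₁ p.1 / φ p.1) • modelGradient g₁.inner φ p.1),
        (f₁ p.1 / φ p.1 ^ 2) • modelHessian g₂.inner f₂ p.2 v.2 +
          (f₂ p.2 * modelDeriv 𝓘(ℝ, E₁) φ p.1 (modelGradient g₁.inner f₁ p.1) /
            φ p.1) • v.2 +
          ((modelDeriv 𝓘(ℝ, E₁) f₁ p.1 v.1 -
            f₁ p.1 / φ p.1 * modelDeriv 𝓘(ℝ, E₁) φ p.1 v.1) / φ p.1 ^ 2) •
            modelGradient g₂.inner f₂ p.2) := by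
  have := FiniteDimensional.complete ℝ E₁
  have := FiniteDimensional.complete ℝ E₂
  have hk : (fun p : M₁ × M₂ => f₁ p.1 * f₂ p.2) ∘
      (extChartAt (𝓘(ℝ, E₁).prod 𝓘(ℝ, E₂)) p).symm = fun u : E₁ × E₂ =>
        (f₁ ∘ (extChartAt 𝓘(ℝ, E₁) p.1).symm) u.1 * (f₂ ∘ (extChartAt 𝓘(ℝ, E₂) p.2).symm) u.2 := by
    rw [extChartAt_prod]
    rfl
  have hc : extChartAt (𝓘(ℝ, E₁).prod 𝓘(ℝ, E₂)) p p =
      (extChartAt 𝓘(ℝ, E₁) p.1 p.1, extChartAt 𝓘(ℝ, E₂) p.2 p.2) := by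
    rw [extChartAt_prod]
    rfl
  have h := (isWarpedOn_inChart g₁ g₂ hφ hφ_pos p).hessian_warp (mem_target_prod_self p)
    (fun _ hu => contDiffAt_comp_extChartAt_symm hf₁ hu)
    (fun _ hu => contDiffAt_comp_extChartAt_symm hf₂ hu) v
  simp only [Function.comp_apply, extChartAt_to_inv] at h
  rw [modelDeriv_eq hf₁, modelDeriv_eq hf₂, modelDeriv_eq hφ,
    modelGradient_eq hf₁, modelGradient_eq hf₂, modelGradient_eq hφ]
  refine Eq.trans ?_ h
  rw [modelHessian, hessian, hc,
    CoordMetric.hessian_congr (inChart_warpedMetric_eventuallyEq _ φ _ p)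
    (Filter.Eventually.of_forall fun u => congrFun hk u)]
  rfl

/-- The Ricci tensor of a warped product. -/
theorem ricci_warpedMetric (p : M₁ × M₂) (v : E₁ × E₂) :
    modelRicci (warpedMetric g₁.inner φ g₂.inner) p v =
      (modelRicci g₁.inner p.1 v.1 -
          ((Module.finrank ℝ E₂ : ℝ) / φ p.1) • modelHessian g₁.inner φ p.1 v.1,
        (φ p.1 ^ 2)⁻¹ • (modelRicci g₂.inner p.2 v.2 -
          (((Module.finrank ℝ E₂ : ℝ) - 1) * modelDeriv 𝓘(ℝ, E₁) φ p.1
            (modelGradient g₁.inner φ p.1) - φ p.1 * laplacian g₁.inner φ p.1) • v.2)) := by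
  have hc : extChartAt (𝓘(ℝ, E₁).prod 𝓘(ℝ, E₂)) p p =
      (extChartAt 𝓘(ℝ, E₁) p.1 p.1, extChartAt 𝓘(ℝ, E₂) p.2 p.2) := by
    rw [extChartAt_prod]
    rfl
  have h := (isWarpedOn_inChart g₁ g₂ hφ hφ_pos p).ricci_warp (mem_target_prod_self p) v
  simp only [Function.comp_apply, extChartAt_to_inv] at h
  rw [modelDeriv_eq hφ, modelGradient_eq hφ]
  refine Eq.trans ?_ (h.trans ?_)
  · rw [modelRicci, ricci, hc,
      CoordMetric.ricci_congr (inChart_warpedMetric_eventuallyEq _ φ _ p)]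
  · refine Prod.ext rfl ?_
    have hl : laplacian g₁.inner φ p.1 = -LinearMap.trace ℝ E₁
      (CoordMetric.hessian (inChart g₁.inner p.1) (φ ∘ (extChartAt 𝓘(ℝ, E₁) p.1).symm)
        (extChartAt 𝓘(ℝ, E₁) p.1 p.1) : E₁ →ₗ[ℝ] E₁) := rfl
    rw [hl]
    refine congrArg (fun a : ℝ => (φ p.1 ^ 2)⁻¹ • (modelRicci g₂.inner p.2 v.2 - a • v.2)) ?_
    ring

end WarpedProduct

end RiemGeom

/-! ### Functions on a Riemannian manifold -/

namespace CoordMetric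

open Filter Topology

variable {E : Type*} [NormedAddCommGroup E] [NormedSpace ℝ E]

theorem gradient_const_mul (G : E → E →L[ℝ] E →L[ℝ] ℝ) (c : ℝ) {h : E → ℝ} {u : E}
    (hh : DifferentiableAt ℝ h u) :
    gradient G (fun v => c * h v) u = c • gradient G h u := by
  rw [gradient, gradient, fderiv_const_mul hh, map_smul]

theorem gradient_const (G : E → E →L[ℝ] E →L[ℝ] ℝ) (c : ℝ) (u : E) :
    gradient G (fun _ => c) u = 0 := by
  rw [gradient, fderiv_const_apply, map_zero]

theorem hessian_const (G : E → E →L[ℝ] E →L[ℝ] ℝ) (c : ℝ) (u : E) :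
    hessian G (fun _ => c) u = 0 := by
  have h : gradient G (fun _ => c) = fun _ => 0 := funext fun v => gradient_const G c v
  rw [hessian, covDeriv, h, fderiv_const_apply, map_zero, add_zero]

namespace IsMetricOn

variable [CompleteSpace E] {G : E → E →L[ℝ] E →L[ℝ] ℝ} {s : Set E} {u : E}
  (hG : IsMetricOn G s) (hu : u ∈ s)
include hG hu

theorem hessian_const_mul (c : ℝ) {h : E → ℝ} (hh : ContDiffAt ℝ ∞ h u) :
    hessian G (fun v => c * h v) u = c • hessian G h u := by
  have hd : ∀ᶠ v in 𝓝 u, DifferentiableAt ℝ h v :=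
    ((hh.of_le (m := 1) (by norm_cast)).eventually (by simp)).mono
      fun v hv => hv.differentiableAt (by simp)
  have e : gradient G (fun v => c * h v) =ᶠ[𝓝 u] fun v => c • gradient G h v :=
    hd.mono fun v hv => gradient_const_mul G c hv
  rw [hessian, hessian, covDeriv, covDeriv, e.fderiv_eq, e.eq_of_nhds,
    fderiv_fun_const_smul ((hG.contDiffAt_gradient hu hh).differentiableAt (by simp)), map_smul,
    smul_add]

theorem continuousAt_fderiv_gradient {h k : E → ℝ} (hh : ContDiffAt ℝ ∞ h u)
    (hk : ContDiffAt ℝ ∞ k u) : ContinuousAt (fun v => fderiv ℝ k v (gradient G h v)) u :=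
  ((hk.fderiv_right (m := ∞) (by simp)).clm_apply (hG.contDiffAt_gradient hu hh)).continuousAt

theorem continuousAt_trace_hessian [FiniteDimensional ℝ E] {h : E → ℝ}
    (hh : ContDiffAt ℝ ∞ h u) :
    ContinuousAt (fun v => LinearMap.trace ℝ E (hessian G h v : E →ₗ[ℝ] E)) u := by
  have h1 : ContinuousAt (hessian G h) u := by
    have a := ((hG.contDiffAt_gradient hu hh).fderiv_right (m := ∞) (by simp)).continuousAt
    have b : ContDiffAt ℝ ∞ (fun v => (christoffel G v).flip) u :=
      (ContinuousLinearMap.flipₗᵢ ℝ E E E).toContinuousLinearEquiv.contDiff.contDiffAt.comp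
        u (hG.contDiffAt_christoffel hu)
    exact a.add (b.clm_apply (hG.contDiffAt_gradient hu hh)).continuousAt
  exact (LinearMap.continuous_of_finiteDimensional
    ((LinearMap.trace ℝ E) ∘ₗ ContinuousLinearMap.coeLM ℝ)).continuousAt.comp h1

end IsMetricOn

end CoordMetric

namespace RiemGeom

open Filter Topology

section General

variable {E : Type*} [NormedAddCommGroup E] [NormedSpace ℝ E]
  {M : Type*} [TopologicalSpace M] [ChartedSpace E M] [IsManifold 𝓘(ℝ, E) ∞ M]

theorem exists_eq_const_of_modelDeriv_eq_zero [ConnectedSpace M] {f : M → ℝ}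
    (hf : ContMDiff 𝓘(ℝ, E) 𝓘(ℝ, ℝ) ∞ f) (h : ∀ x, modelDeriv 𝓘(ℝ, E) f x = 0) :
    ∃ c, ∀ x, f x = c := by
  have hl : IsLocallyConstant f := by
    rw [IsLocallyConstant.iff_eventually_eq]
    intro x
    obtain ⟨r, hr, hb⟩ := Metric.isOpen_iff.1 (isOpen_extChartAt_target (I := 𝓘(ℝ, E)) x) _
      (mem_extChartAt_target x)
    -- the derivative of `f` in the chart vanishes, so `f` is constant on a ball of the chart
    have hz : ∀ u ∈ (extChartAt 𝓘(ℝ, E) x).target,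
        fderiv ℝ (f ∘ (extChartAt 𝓘(ℝ, E) x).symm) u = 0 := by
      intro u hu
      have h1 := mfderiv_comp u (hf.mdifferentiable (by simp) ((extChartAt 𝓘(ℝ, E) x).symm u))
        (mdifferentiableAt_extChartAt_symm (I := 𝓘(ℝ, E)) hu)
      rw [mfderiv_eq_fderiv] at h1
      refine h1.trans ?_
      have h2 := h ((extChartAt 𝓘(ℝ, E) x).symm u)
      refine ContinuousLinearMap.ext fun v => ?_
      exact congrArg (fun A : E →L[ℝ] ℝ => A (chartInvDeriv 𝓘(ℝ, E) x u v)) h2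
    have hc : ∀ u ∈ Metric.ball (extChartAt 𝓘(ℝ, E) x x) r,
        f ((extChartAt 𝓘(ℝ, E) x).symm u) = f x := by
      intro u hu
      have := Metric.isOpen_ball.is_const_of_fderiv_eq_zero
        (convex_ball _ _).isPreconnected
        (fun v hv => ((contDiffAt_comp_extChartAt_symm hf (hb hv)).differentiableAt
          (by simp)).differentiableWithinAt) (fun v hv => hz v (hb hv)) hu
        (Metric.mem_ball_self hr)
      simpa using this
    filter_upwards [extChartAt_source_mem_nhds (I := 𝓘(ℝ, E)) x,
      (continuousAt_extChartAt (I := 𝓘(ℝ, E)) x).preimage_mem_nhds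
        (Metric.ball_mem_nhds _ hr)] with y hy hy'
    rw [← hc _ hy', (extChartAt 𝓘(ℝ, E) x).left_inv hy]
  obtain ⟨x₀⟩ := (inferInstance : Nonempty M)
  exact ⟨f x₀, fun x => hl.apply_eq_of_preconnectedSpace x x₀⟩

/-- If `df = (f/φ) dφ` then `f/φ` is constant. -/
theorem exists_div_eq_const [ConnectedSpace M] {f φ : M → ℝ}
    (hφ : ContMDiff 𝓘(ℝ, E) 𝓘(ℝ, ℝ) ∞ φ) (hφ_pos : ∀ x, 0 < φ x)
    (hf : ContMDiff 𝓘(ℝ, E) 𝓘(ℝ, ℝ) ∞ f)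
    (h : ∀ x v, modelDeriv 𝓘(ℝ, E) f x v = f x / φ x * modelDeriv 𝓘(ℝ, E) φ x v) :
    ∃ c, ∀ x, f x / φ x = c := by
  have hk : ContMDiff 𝓘(ℝ, E) 𝓘(ℝ, ℝ) ∞ (fun x => f x / φ x) :=
    hf.div₀ hφ fun x => (hφ_pos x).ne'
  refine exists_eq_const_of_modelDeriv_eq_zero hk fun x => ?_
  have hx := mem_extChartAt_target (I := 𝓘(ℝ, E)) x
  have d₁ := (contDiffAt_comp_extChartAt_symm hk hx).differentiableAt (by simp)
  have d₂ := (contDiffAt_comp_extChartAt_symm hφ hx).differentiableAt (by simp)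
  have e : f ∘ (extChartAt 𝓘(ℝ, E) x).symm = fun u =>
      ((fun x => f x / φ x) ∘ (extChartAt 𝓘(ℝ, E) x).symm) u *
        (φ ∘ (extChartAt 𝓘(ℝ, E) x).symm) u :=
    funext fun u => (div_mul_cancel₀ _ (hφ_pos _).ne').symm
  ext v
  have hv := h x v
  rw [modelDeriv_eq hf, e, fderiv_fun_mul d₁ d₂, ← modelDeriv_eq hk, ← modelDeriv_eq hφ] at hv
  simp only [_root_.add_apply, _root_.smul_apply, smul_eq_mul, Function.comp_apply,
    extChartAt_to_inv] at hv
  have h0 := (hφ_pos x).ne'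
  have : φ x * modelDeriv 𝓘(ℝ, E) (fun x => f x / φ x) x v = 0 := by linarith
  exact (mul_eq_zero.1 this).resolve_left h0

variable [FiniteDimensional ℝ E]
  (g : Bundle.ContMDiffRiemannianMetric 𝓘(ℝ, E) ∞ E (fun x : M => TangentSpace 𝓘(ℝ, E) x))

theorem modelForm_gradient {f : M → ℝ} (hf : ContMDiff 𝓘(ℝ, E) 𝓘(ℝ, ℝ) ∞ f) (x : M) (v : E) :
    modelForm g.inner x (modelGradient g.inner f x) v = modelDeriv 𝓘(ℝ, E) f x v := by
  rw [modelGradient_eq hf, modelDeriv_eq hf, ← inChart_self,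
    CoordMetric.apply_gradient ((isMetricOn_inChart g x).isInvertible _ (mem_extChartAt_target x))]

omit [FiniteDimensional ℝ E] in
theorem modelForm_symm (x : M) (v w : E) :
    modelForm g.inner x v w = modelForm g.inner x w v :=
  g.symm x v w

theorem modelDeriv_gradient_comm {f h : M → ℝ} (hf : ContMDiff 𝓘(ℝ, E) 𝓘(ℝ, ℝ) ∞ f)
    (hh : ContMDiff 𝓘(ℝ, E) 𝓘(ℝ, ℝ) ∞ h) (x : M) :
    modelDeriv 𝓘(ℝ, E) h x (modelGradient g.inner f x) =
      modelDeriv 𝓘(ℝ, E) f x (modelGradient g.inner h x) := by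
  rw [← modelForm_gradient g hf, ← modelForm_gradient g hh, modelForm_symm]

theorem muOne_eq {h : M → ℝ} (hh : ContMDiff 𝓘(ℝ, E) 𝓘(ℝ, ℝ) ∞ h) (n : ℕ) (x : M) :
    muOne g.inner n h x = ((n : ℝ) - 2) * modelDeriv 𝓘(ℝ, E) h x (modelGradient g.inner h x) -
      h x * laplacian g.inner h x := by
  rw [← modelForm_gradient g hh]
  rfl

theorem muOne'_eq {φ h : M → ℝ} (hφ : ContMDiff 𝓘(ℝ, E) 𝓘(ℝ, ℝ) ∞ φ)
    (hh : ContMDiff 𝓘(ℝ, E) 𝓘(ℝ, ℝ) ∞ h) (n : ℕ) (x : M) :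
    muOne' g.inner n φ h x =
      -(φ x / h x) * modelDeriv 𝓘(ℝ, E) φ x (modelGradient g.inner h x) +
        (((n : ℝ) - 1) * modelDeriv 𝓘(ℝ, E) φ x (modelGradient g.inner φ x) -
          φ x * laplacian g.inner φ x) := by
  rw [modelDeriv_gradient_comm g hh hφ, ← modelForm_gradient g hφ, ← modelForm_gradient g hh,
    ← add_sub_assoc]
  rfl

omit [FiniteDimensional ℝ E] in
theorem modelGradient_const_mul {f : M → ℝ} (hf : ContMDiff 𝓘(ℝ, E) 𝓘(ℝ, ℝ) ∞ f) (c : ℝ)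
    (x : M) :
    modelGradient g.inner (fun x => c * f x) x = c • modelGradient g.inner f x := by
  have h : ContMDiff 𝓘(ℝ, E) 𝓘(ℝ, ℝ) ∞ (fun x => c * f x) := contMDiff_const.mul hf
  rw [modelGradient_eq h, modelGradient_eq hf]
  exact CoordMetric.gradient_const_mul _ c
    ((contDiffAt_comp_extChartAt_symm hf (mem_extChartAt_target x)).differentiableAt (by simp))

theorem modelHessian_const_mul {f : M → ℝ} (hf : ContMDiff 𝓘(ℝ, E) 𝓘(ℝ, ℝ) ∞ f) (c : ℝ)
    (x : M) :
    modelHessian g.inner (fun x => c * f x) x = c • modelHessian g.inner f x := by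
  have := FiniteDimensional.complete ℝ E
  exact (isMetricOn_inChart g x).hessian_const_mul (mem_extChartAt_target x) c
    (contDiffAt_comp_extChartAt_symm hf (mem_extChartAt_target x))

omit [FiniteDimensional ℝ E] in
theorem modelGradient_const (c : ℝ) (x : M) : modelGradient g.inner (fun _ => c) x = 0 := by
  rw [modelGradient_eq contMDiff_const]
  exact CoordMetric.gradient_const _ c _

omit [FiniteDimensional ℝ E] in
theorem modelHessian_const (c : ℝ) (x : M) : modelHessian g.inner (fun _ => c) x = 0 :=
  CoordMetric.hessian_const _ c _

omit [IsManifold 𝓘(ℝ, E) ∞ M] [FiniteDimensional ℝ E] in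
/-- In a chart around `x`, the transition to the preferred chart at a nearby point `x'` does not
change the local representative of a function near `x'`. -/
theorem comp_transition_eventuallyEq (f : M → ℝ) {x x' : M}
    (hx' : x' ∈ (extChartAt 𝓘(ℝ, E) x).source) :
    (f ∘ (extChartAt 𝓘(ℝ, E) x').symm) ∘
        (extChartAt 𝓘(ℝ, E) x' ∘ (extChartAt 𝓘(ℝ, E) x).symm)
      =ᶠ[𝓝 (extChartAt 𝓘(ℝ, E) x x')] f ∘ (extChartAt 𝓘(ℝ, E) x).symm := by
  have hcont : ContinuousAt (extChartAt 𝓘(ℝ, E) x).symm (extChartAt 𝓘(ℝ, E) x x') :=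
    continuousAt_extChartAt_symm'' ((extChartAt 𝓘(ℝ, E) x).map_source hx')
  have hev : ∀ᶠ u in 𝓝 (extChartAt 𝓘(ℝ, E) x x'),
      (extChartAt 𝓘(ℝ, E) x).symm u ∈ (extChartAt 𝓘(ℝ, E) x').source := by
    refine hcont ?_
    rw [(extChartAt 𝓘(ℝ, E) x).left_inv hx']
    exact extChartAt_source_mem_nhds x'
  filter_upwards [hev] with u hu
  simp only [Function.comp_apply]
  rw [(extChartAt 𝓘(ℝ, E) x').left_inv hu]

theorem modelDeriv_gradient_eq_chart {f h : M → ℝ} (hf : ContMDiff 𝓘(ℝ, E) 𝓘(ℝ, ℝ) ∞ f)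
    (hh : ContMDiff 𝓘(ℝ, E) 𝓘(ℝ, ℝ) ∞ h) {x x' : M}
    (hx' : x' ∈ (extChartAt 𝓘(ℝ, E) x).source) :
    modelDeriv 𝓘(ℝ, E) h x' (modelGradient g.inner f x') =
      fderiv ℝ (h ∘ (extChartAt 𝓘(ℝ, E) x).symm) (extChartAt 𝓘(ℝ, E) x x')
        (CoordMetric.gradient (inChart g.inner x) (f ∘ (extChartAt 𝓘(ℝ, E) x).symm)
          (extChartAt 𝓘(ℝ, E) x x')) := by
  have hτ := isPullbackAt_transition g hx'
  have key := hτ.fderiv_gradient_comp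
    ((contDiffAt_comp_extChartAt_symm hf hτ.mem_target).differentiableAt (by simp))
    ((contDiffAt_comp_extChartAt_symm hh hτ.mem_target).differentiableAt (by simp))
  rw [(comp_transition_eventuallyEq h hx').fderiv_eq,
    CoordMetric.gradient_congr rfl (comp_transition_eventuallyEq f hx'), Function.comp_apply,
    (extChartAt 𝓘(ℝ, E) x).left_inv hx'] at key
  rw [modelDeriv_eq hh, modelGradient_eq hf, key]

theorem laplacian_eq_chart {f : M → ℝ} (hf : ContMDiff 𝓘(ℝ, E) 𝓘(ℝ, ℝ) ∞ f) {x x' : M}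
    (hx' : x' ∈ (extChartAt 𝓘(ℝ, E) x).source) :
    laplacian g.inner f x' = -LinearMap.trace ℝ E
      (CoordMetric.hessian (inChart g.inner x) (f ∘ (extChartAt 𝓘(ℝ, E) x).symm)
        (extChartAt 𝓘(ℝ, E) x x') : E →ₗ[ℝ] E) := by
  have := FiniteDimensional.complete ℝ E
  have hτ := isPullbackAt_transition g hx'
  have key := hτ.trace_hessian_comp (contDiffAt_comp_extChartAt_symm hf hτ.mem_target)
  rw [CoordMetric.hessian_congr (EventuallyEq.refl _ _) (comp_transition_eventuallyEq f hx'),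
    Function.comp_apply, (extChartAt 𝓘(ℝ, E) x).left_inv hx'] at key
  rw [key]
  rfl

/-- The function `g(∇f, ∇h)` is continuous. -/
theorem continuous_modelDeriv_gradient {f h : M → ℝ} (hf : ContMDiff 𝓘(ℝ, E) 𝓘(ℝ, ℝ) ∞ f)
    (hh : ContMDiff 𝓘(ℝ, E) 𝓘(ℝ, ℝ) ∞ h) :
    Continuous fun x => modelDeriv 𝓘(ℝ, E) h x (modelGradient g.inner f x) := by
  have := FiniteDimensional.complete ℝ E
  refine continuous_iff_continuousAt.2 fun x => ?_
  have hx := mem_extChartAt_target (I := 𝓘(ℝ, E)) x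
  have hc := ContinuousAt.comp (f := extChartAt 𝓘(ℝ, E) x) (x := x)
    ((isMetricOn_inChart g x).continuousAt_fderiv_gradient hx
    (contDiffAt_comp_extChartAt_symm hf hx) (contDiffAt_comp_extChartAt_symm hh hx))
    (continuousAt_extChartAt x)
  refine hc.congr ?_
  filter_upwards [extChartAt_source_mem_nhds (I := 𝓘(ℝ, E)) x] with x' hx'
  exact (modelDeriv_gradient_eq_chart g hf hh hx').symm

theorem continuous_laplacian {f : M → ℝ} (hf : ContMDiff 𝓘(ℝ, E) 𝓘(ℝ, ℝ) ∞ f) :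
    Continuous (laplacian g.inner f) := by
  have := FiniteDimensional.complete ℝ E
  refine continuous_iff_continuousAt.2 fun x => ?_
  have hx := mem_extChartAt_target (I := 𝓘(ℝ, E)) x
  have hc := ContinuousAt.comp (f := extChartAt 𝓘(ℝ, E) x) (x := x)
    ((isMetricOn_inChart g x).continuousAt_trace_hessian hx
    (contDiffAt_comp_extChartAt_symm hf hx)) (continuousAt_extChartAt x)
  refine hc.neg.congr ?_
  filter_upwards [extChartAt_source_mem_nhds (I := 𝓘(ℝ, E)) x] with x' hx'
  exact (laplacian_eq_chart g hf hx').symm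

end General

end RiemGeom

/-! ### The equation on a warped product -/

namespace RiemGeom

open Filter Topology

section Equation

variable {E₁ : Type*} [NormedAddCommGroup E₁] [NormedSpace ℝ E₁] [FiniteDimensional ℝ E₁]
  {M₁ : Type*} [TopologicalSpace M₁] [ChartedSpace E₁ M₁] [IsManifold 𝓘(ℝ, E₁) ∞ M₁]
  {E₂ : Type*} [NormedAddCommGroup E₂] [NormedSpace ℝ E₂] [FiniteDimensional ℝ E₂]
  {M₂ : Type*} [TopologicalSpace M₂] [ChartedSpace E₂ M₂] [IsManifold 𝓘(ℝ, E₂) ∞ M₂]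
  (g₁ : Bundle.ContMDiffRiemannianMetric 𝓘(ℝ, E₁) ∞ E₁
    (fun x : M₁ => TangentSpace 𝓘(ℝ, E₁) x))
  (g₂ : Bundle.ContMDiffRiemannianMetric 𝓘(ℝ, E₂) ∞ E₂
    (fun x : M₂ => TangentSpace 𝓘(ℝ, E₂) x))
  {φ : M₁ → ℝ} (hφ : ContMDiff 𝓘(ℝ, E₁) 𝓘(ℝ, ℝ) ∞ φ) (hφ_pos : ∀ x, 0 < φ x)
  {f₁ : M₁ → ℝ} (hf₁ : ContMDiff 𝓘(ℝ, E₁) 𝓘(ℝ, ℝ) ∞ f₁)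
  {f₂ : M₂ → ℝ} (hf₂ : ContMDiff 𝓘(ℝ, E₂) 𝓘(ℝ, ℝ) ∞ f₂)
include hφ hφ_pos hf₁ hf₂

/-- The four blocks of the equation `∇²f = -f Ric` on a warped product: the two diagonal blocks and
the two mixed blocks, in which `d(f₁/φ)` is paired with `df₂`. -/
theorem solvesRicciHessian_warpedMetric_iff :
    SolvesRicciHessian (warpedMetric g₁.inner φ g₂.inner)
        (fun p : M₁ × M₂ => f₁ p.1 * f₂ p.2) ↔
      ∀ x y, (∀ v, f₂ y • modelHessian g₁.inner f₁ x v =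
          -((f₁ x * f₂ y) • (modelRicci g₁.inner x v -
            ((Module.finrank ℝ E₂ : ℝ) / φ x) • modelHessian g₁.inner φ x v))) ∧
        (∀ w, modelDeriv 𝓘(ℝ, E₂) f₂ y w • (modelGradient g₁.inner f₁ x -
          (f₁ x / φ x) • modelGradient g₁.inner φ x) = 0) ∧
        (∀ w, f₁ x • modelHessian g₂.inner f₂ y w +
            (f₂ y * φ x * modelDeriv 𝓘(ℝ, E₁) φ x (modelGradient g₁.inner f₁ x)) • w =
          -((f₁ x * f₂ y) • (modelRicci g₂.inner y w -
            (((Module.finrank ℝ E₂ : ℝ) - 1) *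
                modelDeriv 𝓘(ℝ, E₁) φ x (modelGradient g₁.inner φ x) -
              φ x * laplacian g₁.inner φ x) • w))) ∧
        ∀ v, (modelDeriv 𝓘(ℝ, E₁) f₁ x v - f₁ x / φ x * modelDeriv 𝓘(ℝ, E₁) φ x v) •
          modelGradient g₂.inner f₂ y = 0 := by
  have hpt (x : M₁) (y : M₂) : hessian (warpedMetric g₁.inner φ g₂.inner)
        (fun p : M₁ × M₂ => f₁ p.1 * f₂ p.2) (x, y) =
        -((f₁ x * f₂ y) • ricci (warpedMetric g₁.inner φ g₂.inner) (x, y)) ↔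
      ∀ v : E₁ × E₂, modelHessian (warpedMetric g₁.inner φ g₂.inner)
        (fun p : M₁ × M₂ => f₁ p.1 * f₂ p.2) (x, y) v =
        -((f₁ x * f₂ y) • modelRicci (warpedMetric g₁.inner φ g₂.inner) (x, y) v) :=
    ⟨fun h v => congrArg (fun A : E₁ × E₂ →L[ℝ] E₁ × E₂ => A v) h,
      fun h => ContinuousLinearMap.ext h⟩
  refine Prod.forall.trans (forall_congr' fun x => forall_congr' fun y => (hpt x y).trans ?_)
  have h0 := (hφ_pos x).ne'
  simp only [hessian_warpedMetric g₁ g₂ hφ hφ_pos hf₁ hf₂, ricci_warpedMetric g₁ g₂ hφ hφ_pos,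
    Prod.smul_mk, Prod.neg_mk, Prod.mk.injEq]
  constructor
  · intro h
    refine ⟨fun v => ?_, fun w => ?_, fun w => ?_, fun v => ?_⟩
    · simpa using (h (v, 0)).1
    · simpa using (h (0, w)).1
    · -- clear the denominator `φ²` in the block along the second factor
      have := congrArg (fun z => φ x ^ 2 • z) (h (0, w)).2
      simp only [map_zero, mul_zero, sub_zero, zero_div, zero_smul, add_zero, smul_add,
        smul_neg, smul_smul] at this
      convert this using 2
      · congr 1
        field_simp
      · congr 1
        field_simp
      · congr 1
        field_simp
    · have := (h (v, 0)).2
      simp only [map_zero, smul_zero, zero_add, sub_zero, neg_zero] at this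
      have h2 := congrArg (fun z => φ x ^ 2 • z) this
      simpa only [smul_smul, mul_div_cancel₀ _ (pow_ne_zero 2 h0), smul_zero] using h2
  · rintro ⟨h1, h2, h3, h4⟩ ⟨v, w⟩
    refine ⟨?_, ?_⟩
    · rw [h1, h2, add_zero]
    · have k3 := congrArg (fun z => (φ x ^ 2)⁻¹ • z) (h3 w)
      have k4 : ((modelDeriv 𝓘(ℝ, E₁) f₁ x v - f₁ x / φ x * modelDeriv 𝓘(ℝ, E₁) φ x v) /
          φ x ^ 2) • modelGradient g₂.inner f₂ y = 0 := by
        rw [div_eq_inv_mul, ← smul_smul, h4, smul_zero]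
      simp only [smul_add, smul_neg, smul_smul] at k3
      rw [k4, add_zero]
      convert k3 using 2
      · congr 1
        field_simp
      · congr 1
        field_simp
      · rw [smul_smul]
        congr 1
        ring

omit [FiniteDimensional ℝ E₂] hφ_pos hf₂ in
/-- If `μ₁'` is equal to the constant `c` where `f₁ ≠ 0`, then the identity obtained by clearing
the denominator `f₁` holds also at the zeros of `f₁`: by continuity on the closure of
`{f₁ ≠ 0}`, and in the interior of the zero set because `∇f₁ = 0` there. -/
theorem mul_modelDeriv_gradient_eq_of_muOne' {n : ℕ} {c : ℝ}
    (h : ∀ x, f₁ x ≠ 0 → muOne' g₁.inner n φ f₁ x = c) (x : M₁) :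
    φ x * modelDeriv 𝓘(ℝ, E₁) φ x (modelGradient g₁.inner f₁ x) =
      f₁ x * (((n : ℝ) - 1) * modelDeriv 𝓘(ℝ, E₁) φ x (modelGradient g₁.inner φ x) -
        φ x * laplacian g₁.inner φ x - c) := by
  have hcl : IsClosed {x | φ x * modelDeriv 𝓘(ℝ, E₁) φ x (modelGradient g₁.inner f₁ x) =
      f₁ x * (((n : ℝ) - 1) * modelDeriv 𝓘(ℝ, E₁) φ x (modelGradient g₁.inner φ x) -
        φ x * laplacian g₁.inner φ x - c)} :=
    isClosed_eq (hφ.continuous.mul (continuous_modelDeriv_gradient g₁ hf₁ hφ))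
      (hf₁.continuous.mul (((continuous_const.mul (continuous_modelDeriv_gradient g₁ hφ hφ)).sub
        (hφ.continuous.mul (continuous_laplacian g₁ hφ))).sub continuous_const))
  have hsub : {x | f₁ x ≠ 0} ⊆ {x | φ x * modelDeriv 𝓘(ℝ, E₁) φ x (modelGradient g₁.inner f₁ x) =
      f₁ x * (((n : ℝ) - 1) * modelDeriv 𝓘(ℝ, E₁) φ x (modelGradient g₁.inner φ x) -
        φ x * laplacian g₁.inner φ x - c)} := by
    intro x hx
    have hx' : f₁ x ≠ 0 := hx
    rw [Set.mem_ofPred_eq, ← h x hx', muOne'_eq g₁ hφ hf₁]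
    field_simp
    ring
  by_cases hx : x ∈ closure {x | f₁ x ≠ 0}
  · exact hcl.closure_subset_iff.2 hsub hx
  · have hz : f₁ =ᶠ[𝓝 x] fun _ => 0 := by
      filter_upwards [isClosed_closure.isOpen_compl.mem_nhds hx] with z hz
      by_contra hne
      exact hz (subset_closure hne)
    have hd : modelDeriv 𝓘(ℝ, E₁) f₁ x = 0 := hz.mfderiv_eq.trans mfderiv_const
    rw [modelDeriv_gradient_comm g₁ hf₁ hφ, hd, hz.eq_of_nhds]
    simp

end Equation

end RiemGeom

theorem mainTheorem7
    {E₁ : Type*} [NormedAddCommGroup E₁] [NormedSpace ℝ E₁] [FiniteDimensional ℝ E₁]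
    {M₁ : Type*} [TopologicalSpace M₁] [T2Space M₁] [SecondCountableTopology M₁]
    [ConnectedSpace M₁] [ChartedSpace E₁ M₁] [IsManifold 𝓘(ℝ, E₁) ∞ M₁]
    {E₂ : Type*} [NormedAddCommGroup E₂] [NormedSpace ℝ E₂] [FiniteDimensional ℝ E₂]
    {M₂ : Type*} [TopologicalSpace M₂] [T2Space M₂] [SecondCountableTopology M₂]
    [ConnectedSpace M₂] [ChartedSpace E₂ M₂] [IsManifold 𝓘(ℝ, E₂) ∞ M₂]
    (n₂ : ℕ) (hdim₂ : Module.finrank ℝ E₂ = n₂) (hn₂ : 1 ≤ n₂)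
    (g₁ : Bundle.ContMDiffRiemannianMetric 𝓘(ℝ, E₁) ∞ E₁
      (fun x : M₁ => TangentSpace 𝓘(ℝ, E₁) x))
    (g₂ : Bundle.ContMDiffRiemannianMetric 𝓘(ℝ, E₂) ∞ E₂
      (fun x : M₂ => TangentSpace 𝓘(ℝ, E₂) x))
    (φ : M₁ → ℝ) (hφ : ContMDiff 𝓘(ℝ, E₁) 𝓘(ℝ, ℝ) ∞ φ) (hφ_pos : ∀ x, 0 < φ x)
    (f₁ : M₁ → ℝ) (hf₁ : ContMDiff 𝓘(ℝ, E₁) 𝓘(ℝ, ℝ) ∞ f₁)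
    (f₂ : M₂ → ℝ) (hf₂ : ContMDiff 𝓘(ℝ, E₂) 𝓘(ℝ, ℝ) ∞ f₂)
    (hf : ∃ p : M₁ × M₂, f₁ p.1 * f₂ p.2 ≠ 0) :
    RiemGeom.SolvesRicciHessian (warpedMetric g₁.inner φ g₂.inner)
        (fun p : M₁ × M₂ => f₁ p.1 * f₂ p.2) ↔
      -- case (a): `f₁ / φ` is a constant `c`; the equations are those of `f₁ / c = φ` and `f₂`
      ((∃ c : ℝ, ∀ x, f₁ x / φ x = c) ∧
        ∃ μ₁ : ℝ,
          (∀ x, RiemGeom.muOne g₁.inner n₂ φ x = μ₁) ∧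
          (∀ x, ((n₂ : ℝ) - 1) • RiemGeom.hessian g₁.inner φ x =
              φ x • RiemGeom.ricci g₁.inner x) ∧
          (∀ y, RiemGeom.hessian g₂.inner f₂ y =
              f₂ y • (μ₁ • ContinuousLinearMap.id ℝ (TangentSpace 𝓘(ℝ, E₂) y) -
                RiemGeom.ricci g₂.inner y))) ∨
      -- case (b): `f₂` is constant
      ((∃ c : ℝ, ∀ y, f₂ y = c) ∧
        (∀ x, RiemGeom.hessian g₁.inner f₁ x =
            -(f₁ x • (RiemGeom.ricci g₁.inner x -
              ((n₂ : ℝ) / φ x) • RiemGeom.hessian g₁.inner φ x))) ∧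
        (∀ x, f₁ x ≠ 0 → ∀ x' ∈ connectedComponentIn {z | f₁ z ≠ 0} x,
          RiemGeom.muOne' g₁.inner n₂ φ f₁ x' = RiemGeom.muOne' g₁.inner n₂ φ f₁ x) ∧
        RiemGeom.IsEinstein g₂.inner ∧
        (∀ x, f₁ x ≠ 0 → ∀ y,
          RiemGeom.scalarCurvature g₂.inner y = (n₂ : ℝ) * RiemGeom.muOne' g₁.inner n₂ φ f₁ x)) := by
  have hfin : (Module.finrank ℝ E₂ : ℝ) = n₂ := by rw [hdim₂]
  obtain ⟨⟨x₀, y₀⟩, hp⟩ := hf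
  obtain ⟨hx₀, hy₀⟩ : f₁ x₀ ≠ 0 ∧ f₂ y₀ ≠ 0 := mul_ne_zero_iff.1 hp
  have : Nontrivial E₂ := Module.nontrivial_of_finrank_pos (R := ℝ) (by omega)
  obtain ⟨w₀, hw₀⟩ := exists_ne (0 : E₂)
  have hφ0 : ∀ x, φ x ≠ 0 := fun x => (hφ_pos x).ne'
  rw [RiemGeom.solvesRicciHessian_warpedMetric_iff g₁ g₂ hφ hφ_pos hf₁ hf₂, hfin]
  constructor
  · intro h
    -- the mixed blocks vanish, so `∇f₁ = (f₁/φ) ∇φ` everywhere unless `df₂ = 0` everywhere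
    by_cases hX : ∀ x, RiemGeom.modelGradient g₁.inner f₁ x -
        (f₁ x / φ x) • RiemGeom.modelGradient g₁.inner φ x = 0
    · left
      obtain ⟨c, hc⟩ := RiemGeom.exists_div_eq_const hφ hφ_pos hf₁ fun x v => by
        rw [← RiemGeom.modelForm_gradient g₁ hf₁, sub_eq_zero.1 (hX x), map_smul,
          ← RiemGeom.modelForm_gradient g₁ hφ]
        rfl
      have hf₁φ : f₁ = fun x => c * φ x := funext fun x => by rw [← hc x, div_mul_cancel₀ _ (hφ0 x)]
      have hc0 : c ≠ 0 := by
        rintro rfl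
        exact hx₀ (by simp [hf₁φ])
      have hH : ∀ x y w, RiemGeom.modelHessian g₂.inner f₂ y w =
          f₂ y • (RiemGeom.muOne g₁.inner n₂ φ x • w - RiemGeom.modelRicci g₂.inner y w) := by
        intro x y w
        have h3 := (h x y).2.2.1 w
        rw [hf₁φ, RiemGeom.modelGradient_const_mul g₁ hφ, map_smul, smul_eq_mul] at h3
        have h4 := congrArg (fun z => (c * φ x)⁻¹ • z) h3
        simp only [smul_add, inv_smul_smul₀ (mul_ne_zero hc0 (hφ0 x))] at h4
        rw [RiemGeom.muOne_eq g₁ hφ, eq_sub_of_add_eq h4]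
        have := hφ0 x
        match_scalars <;> field_simp
        ring
      have hK : ∀ x v, ((n₂ : ℝ) - 1) • RiemGeom.modelHessian g₁.inner φ x v =
          φ x • RiemGeom.modelRicci g₁.inner x v := by
        intro x v
        have h1 := (h x y₀).1 v
        rw [hf₁φ, RiemGeom.modelHessian_const_mul g₁ hφ, _root_.smul_apply] at h1
        have h2 := congrArg (fun z => (f₂ y₀ * c)⁻¹ • z) h1
        simp only [smul_smul] at h2
        rw [inv_mul_cancel₀ (mul_ne_zero hy₀ hc0), one_smul] at h2
        have := hφ0 x
        rw [sub_smul, one_smul]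
        nth_rewrite 2 [h2]
        match_scalars <;> field_simp
        ring
      -- in `hH` only `μ₁` depends on `x`; evaluate at `y₀` and at a nonzero vector `w₀`
      refine ⟨⟨c, hc⟩, RiemGeom.muOne g₁.inner n₂ φ x₀, fun x => ?_, fun x => ?_, fun y => ?_⟩
      · have h1 := (hH x y₀ w₀).symm.trans (hH x₀ y₀ w₀)
        exact smul_left_injective ℝ hw₀ (sub_left_injective (smul_right_injective E₂ hy₀ h1))
      · exact ContinuousLinearMap.ext fun v => hK x v
      · exact ContinuousLinearMap.ext fun w => hH x₀ y w
    · right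
      push Not at hX
      obtain ⟨x₁, hx₁⟩ := hX
      obtain ⟨c, hc⟩ := RiemGeom.exists_eq_const_of_modelDeriv_eq_zero hf₂ fun y =>
        ContinuousLinearMap.ext fun w => (smul_eq_zero.1 ((h x₁ y).2.1 w)).resolve_right hx₁
      obtain rfl : f₂ = fun _ => c := funext hc
      have hR : ∀ x, f₁ x ≠ 0 → ∀ y w, RiemGeom.modelRicci g₂.inner y w =
          RiemGeom.muOne' g₁.inner n₂ φ f₁ x • w := by
        intro x hx y w
        have h3 := (h x y).2.2.1 w
        rw [RiemGeom.modelHessian_const g₂, _root_.zero_apply, smul_zero, zero_add] at h3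
        have h4 := congrArg (fun z => (f₁ x * c)⁻¹ • z) h3
        simp only [smul_neg, inv_smul_smul₀ (mul_ne_zero hx hy₀)] at h4
        rw [RiemGeom.muOne'_eq g₁ hφ hf₁, add_smul, ← sub_eq_iff_eq_add, ← neg_eq_iff_eq_neg.2 h4]
        match_scalars
        field_simp
      have hμ : ∀ x, f₁ x ≠ 0 → ∀ x', f₁ x' ≠ 0 →
          RiemGeom.muOne' g₁.inner n₂ φ f₁ x' = RiemGeom.muOne' g₁.inner n₂ φ f₁ x := by
        intro x hx x' hx'
        exact smul_left_injective ℝ hw₀ ((hR x' hx' y₀ w₀).symm.trans (hR x hx y₀ w₀))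
      have hK : ∀ x v, RiemGeom.modelHessian g₁.inner f₁ x v =
          -(f₁ x • (RiemGeom.modelRicci g₁.inner x v -
            ((n₂ : ℝ) / φ x) • RiemGeom.modelHessian g₁.inner φ x v)) := by
        intro x v
        have h1 := (h x y₀).1 v
        rw [mul_comm, ← smul_smul, ← smul_neg] at h1
        exact smul_right_injective E₁ hy₀ h1
      refine ⟨⟨c, hc⟩, fun x => ContinuousLinearMap.ext fun v => hK x v, fun x hx x' hx' => ?_,
        ⟨_, fun y => ContinuousLinearMap.ext fun w => hR x₀ hx₀ y w⟩, fun x hx y => ?_⟩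
      · exact hμ x hx x' (connectedComponentIn_subset _ _ hx')
      · have h1 : RiemGeom.scalarCurvature g₂.inner y = LinearMap.trace ℝ E₂
            (RiemGeom.muOne' g₁.inner n₂ φ f₁ x • LinearMap.id) :=
          congrArg (LinearMap.trace ℝ E₂) (LinearMap.ext fun w => hR x hx y w)
        rw [h1, map_smul, LinearMap.trace_id, hfin, smul_eq_mul, mul_comm]
  · rintro (⟨⟨c, hc⟩, μ₁, hμ, h1, h2⟩ | ⟨⟨c, hc⟩, h1, -, ⟨c', hE⟩, hS⟩)
    · have hf₁φ : f₁ = fun x => c * φ x := funext fun x => by rw [← hc x, div_mul_cancel₀ _ (hφ0 x)]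
      have h1' : ∀ x v, ((n₂ : ℝ) - 1) • RiemGeom.modelHessian g₁.inner φ x v =
          φ x • RiemGeom.modelRicci g₁.inner x v := fun x v =>
        congrArg (fun A : E₁ →L[ℝ] E₁ => A v) (h1 x)
      have h2' : ∀ y w, RiemGeom.modelHessian g₂.inner f₂ y w =
          f₂ y • (μ₁ • w - RiemGeom.modelRicci g₂.inner y w) := fun y w =>
        congrArg (fun A : E₂ →L[ℝ] E₂ => A w) (h2 y)
      have hd : ∀ x, RiemGeom.modelGradient g₁.inner f₁ x -
          (f₁ x / φ x) • RiemGeom.modelGradient g₁.inner φ x = 0 := fun x => by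
        rw [hc x, hf₁φ, RiemGeom.modelGradient_const_mul g₁ hφ, sub_self]
      intro x y
      refine ⟨fun v => ?_, fun w => ?_, fun w => ?_, fun v => ?_⟩
      · rw [hf₁φ, RiemGeom.modelHessian_const_mul g₁ hφ, _root_.smul_apply]
        have h3 : RiemGeom.modelRicci g₁.inner x v =
            (((n₂ : ℝ) - 1) / φ x) • RiemGeom.modelHessian g₁.inner φ x v := by
          rw [div_eq_inv_mul, ← smul_smul, h1', inv_smul_smul₀ (hφ0 x)]
        have := hφ0 x
        rw [h3]
        match_scalars
        field_simp
        ring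
      · rw [hd, smul_zero]
      · rw [h2', ← hμ x, RiemGeom.muOne_eq g₁ hφ, hf₁φ, RiemGeom.modelGradient_const_mul g₁ hφ,
          map_smul, smul_eq_mul]
        match_scalars <;> ring
      · have h3 := hd x
        rw [← RiemGeom.modelForm_gradient g₁ hf₁, sub_eq_zero.1 h3, map_smul, _root_.smul_apply,
          RiemGeom.modelForm_gradient g₁ hφ, smul_eq_mul, sub_self, zero_smul]
    · obtain rfl : f₂ = fun _ => c := funext hc
      have hE' : ∀ y w, RiemGeom.modelRicci g₂.inner y w = c' • w := fun y w =>
        congrArg (fun A : E₂ →L[ℝ] E₂ => A w) (hE y)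
      have hμ : ∀ x, f₁ x ≠ 0 → RiemGeom.muOne' g₁.inner n₂ φ f₁ x = c' := by
        intro x hx
        have h3 : RiemGeom.scalarCurvature g₂.inner y₀ = LinearMap.trace ℝ E₂
            (c' • LinearMap.id) :=
          congrArg (LinearMap.trace ℝ E₂) (LinearMap.ext fun w => hE' y₀ w)
        rw [hS x hx y₀, map_smul, LinearMap.trace_id, hfin, smul_eq_mul, mul_comm] at h3
        exact mul_right_cancel₀ (Nat.cast_ne_zero.2 (by omega)) h3
      have h1' : ∀ x v, RiemGeom.modelHessian g₁.inner f₁ x v =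
          -(f₁ x • (RiemGeom.modelRicci g₁.inner x v -
            ((n₂ : ℝ) / φ x) • RiemGeom.modelHessian g₁.inner φ x v)) := fun x v =>
        congrArg (fun A : E₁ →L[ℝ] E₁ => A v) (h1 x)
      have hd : ∀ y, RiemGeom.modelDeriv 𝓘(ℝ, E₂) (fun _ : M₂ => c) y = 0 := fun y => mfderiv_const
      intro x y
      refine ⟨fun v => ?_, fun w => ?_, fun w => ?_, fun v => ?_⟩
      · rw [h1', mul_comm, ← smul_smul, smul_neg]
      · rw [hd, _root_.zero_apply, zero_smul]
      · -- at the zeros of `f₁` this identity is not contained in the hypothesis on `μ₁'`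
        rw [RiemGeom.modelHessian_const g₂, _root_.zero_apply, smul_zero, zero_add, mul_assoc,
          RiemGeom.mul_modelDeriv_gradient_eq_of_muOne' g₁ hφ hf₁ hμ, hE']
        match_scalars
        ring
      · rw [RiemGeom.modelGradient_const g₂, smul_zero]
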